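/- Let $0<\nu<1$, and put $w=\tfrac12$, $\mu=\tfrac{1-\nu}{2}$. For $L\ge 2$ consider diffusion-limited pair annihilation and deposition on the torus $\mathbb T_L=\mathbb Z/L\mathbb Z$ together with its activity: the continuous-time Markov chain on $\{0,1\}^{\mathbb T_L}\times\mathbb N_0$ with generator $$(\tilde{\mathcal H}f)(\eta,A)=\sum_{k=0}^{L-1}\Big[\mu f(\bar\eta^{\,k,k+1},A)+w(\eta_k+\eta_{k+1})f(\bar\eta^{\,k,k+1},A+1)-\big(\mu+w(\eta_k+\eta_{k+1})\big)f(\eta,A)\Big],$$ where $\bar\eta^{\,k,k+1}$ is $\eta$ with the occupation numbers at the sites $k$ and $k+1$ replaced by $1-\eta_k$ and $1-\eta_{k+1}$. Write $\langle\cdot\rangle_{\eta,0}$ for the expectation of the chain started in $(\eta,0)$, and $A(t)$ for the activity at time $t$. Then for every $L\ge 2$ and every $s\in\mathbb R$ the limit $$K_L(s)=\lim_{t\to\infty}\frac{1}{Lt}\ln\big\langle e^{sA(t)}\big\rangle_{\eta,0}$$ exists and is the same for all $\eta$ with an even number of particles, and $K_L$ is three times continuously differentiable near the critical point $s_c=\ln(1-\mu/w)=\ln\nu$.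 Let $\kappa^c_n(L)=K_L^{(n)}(s_c)$ for $n=2,3$ be the critical cumulants in the even sector, and let $S^c(L)=\kappa^c_3(L)/(\kappa^c_2(L))^{3/2}$ be the critical skewness. As $L\to\infty$, $$\kappa^c_3(L)\sim\frac34\,\frac{\nu^2(2-\nu)}{(1-\nu^2)^{3/2}\,\pi}\,\ln L ,$$ and the critical skewness tends to $0$, with $$S^c(L)\sim\frac{3(2-\nu)}{\nu(1-\nu^2)^{3/4}}\sqrt{\frac{\pi}{2\ln L}} .$$ Here $a_L\sim b_L$ means that $a_L/b_L\to1$. -/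

import Mathlib

open Filter Topology Asymptotics

noncomputable section

namespace DLPAD

/-- Configurations on the integer torus with `L` sites: `true` means that the site is occupied. -/
abbrev Config (L : ℕ) : Type := ZMod L → Bool

/-- The occupation number at site `k`, as a real number. -/
def occ {L : ℕ} (η : Config L) (k : ZMod L) : ℝ := ((η k).toNat : ℝ)

/-- The configuration flipped at the two sites `k` and `k + 1`. -/
def flip {L : ℕ} (η : Config L) (k : ZMod L) : Config L :=
  fun j => if j = k ∨ j = k + 1 then !(η j) else η j

/-- The even sector: configurations with an even number of particles. -/
def IsEven {L : ℕ} (η : Config L) : Prop :=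
  Even (∑ k ∈ Finset.range L, (η (k : ZMod L)).toNat)

/-- The generator of the joint process (configuration, activity). On each bond `(k, k + 1)` a
deposition event of rate `μ` flips the bond and keeps the activity, and a particle jump, of rate
`w * (η k + η (k + 1))`, flips the bond and raises the activity by one. -/
def jointGenerator (w μ : ℝ) (L : ℕ) (f : Config L × ℕ → ℝ) : Config L × ℕ → ℝ :=
  fun x => ∑ k ∈ Finset.range L,
    (μ * f (flip x.1 (k : ZMod L), x.2)
      + w * (occ x.1 (k : ZMod L) + occ x.1 ((k : ZMod L) + 1))
          * f (flip x.1 (k : ZMod L), x.2 + 1)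
      - (μ + w * (occ x.1 (k : ZMod L) + occ x.1 ((k : ZMod L) + 1))) * f x)

/-- The Markov semigroup `exp (t * jointGenerator)` of the joint process. The jump rates are bounded,
so that the exponential series converges absolutely on bounded functions `f`, and its value at `x`
is the expectation of `f` at time `t` for the process started in `x`. -/
def semigroup (w μ : ℝ) (L : ℕ) (t : ℝ) (f : Config L × ℕ → ℝ) (x : Config L × ℕ) : ℝ :=
  ∑' m : ℕ, t ^ m / (m.factorial : ℝ) * ((jointGenerator w μ L)^[m] f) x

/-- The probability that the activity at time `t` equals `n`, for the joint process started in
configuration `η` with activity `0`. -/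
def activityProb (w μ : ℝ) (L : ℕ) (η : Config L) (t : ℝ) (n : ℕ) : ℝ :=
  semigroup w μ L t (fun x => if x.2 = n then 1 else 0) (η, 0)

/-- The moment generating function of the activity at time `t`, started in `η`. -/
def activityMGF (w μ : ℝ) (L : ℕ) (η : Config L) (s t : ℝ) : ℝ :=
  ∑' n : ℕ, activityProb w μ L η t n * Real.exp (s * n)

/-- The cumulant generating function of the activity per site and unit of time. -/
def scaledCGF (w μ : ℝ) (L : ℕ) (η : Config L) (s t : ℝ) : ℝ :=
  Real.log (activityMGF w μ L η s t) / (L * t)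

/-- The limiting cumulant generating function in the even sector: the long-time limit of
`scaledCGF`, started in the empty configuration. -/
def limitingCGF (w μ : ℝ) (L : ℕ) (s : ℝ) : ℝ :=
  limUnder atTop (fun t : ℝ => scaledCGF w μ L (fun _ => false) s t)

/-- The limiting cumulant generating function with `w = 1/2` and `μ = (1 - ν) / 2`. -/
def cgf (ν : ℝ) (L : ℕ) (s : ℝ) : ℝ := limitingCGF (1 / 2) ((1 - ν) / 2) L s

/-- The critical value `log (1 - μ / w)` of the Legendre parameter, for `w = 1/2` and
`μ = (1 - ν) / 2`. -/
def sCrit (ν : ℝ) : ℝ := Real.log (1 - ((1 - ν) / 2) / (1 / 2))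

/-- The `n`-th critical cumulant. -/
def criticalCumulant (ν : ℝ) (n L : ℕ) : ℝ := iteratedDeriv n (cgf ν L) (sCrit ν)

/-- The critical skewness. -/
def criticalSkewness (ν : ℝ) (L : ℕ) : ℝ :=
  criticalCumulant ν 3 L / (criticalCumulant ν 2 L) ^ (3 / 2 : ℝ)

end DLPAD

end

/-!
By the Feynman–Kac formula `⟨exp (s A(t))⟩` is `exp (t G) 1` for the generator `G` whose activity
raising jumps are weighted with `exp s`, and by Perron–Frobenius its growth rate in the even sector
is the eigenvalue of any positive even eigenvector. The Jordan–Wigner transformation makes `G`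
quadratic in fermions with antiperiodic momenta `q`. A product of pair creators applied to the
vacuum is an eigenvector when each pair amplitude solves a Riccati equation; the discriminants `Δ`
of these equations give the eigenvalue `∑ √Δ / 2 - (μ + w) L`. The components of this eigenvector
are positive: at an even eigenvector with nonnegative components none of them can vanish, so
positivity is an open and closed condition in `exp s`; it holds at `s = 0`, where the eigenvector is
harmonic for the Markov chain, hence constant.

At `s = ln ν` the discriminant degenerates to `4 σ² ρ(σ)` with `σ = sin (q / 2)` and `ρ` positive.
Each `√Δ` then contributes `Ψ(σ) / σ` to the second and to the third derivative, with `Ψ` smooth,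
and the sum of `1 / σ` over the momenta `q = (2 m + 1) π / L` grows as `(2 / π) L ln L`.
-/

namespace DLPAD

section Fourier

/-- The antiperiodic momenta: in the even sector the Jordan–Wigner fermions change sign around the
torus. -/
noncomputable def momentum (L m : ℕ) : ℝ := (2 * m + 1) * Real.pi / L

/-- The phase factor of an antiperiodic momentum. The momentum opposite to the one of index `m` has
index `L - 1 - m`. -/
noncomputable def phase (L m : ℕ) : ℂ := Complex.exp (momentum L m * Complex.I)

variable {L : ℕ}

theorem momentum_reflect {m : ℕ} (hm : m < L) :
    momentum L (L - 1 - m) = 2 * Real.pi - momentum L m := by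
  have hL : (L : ℝ) ≠ 0 := Nat.cast_ne_zero.2 (by omega)
  obtain ⟨k, rfl⟩ : ∃ k, L = m + 1 + k := ⟨L - 1 - m, by omega⟩
  rw [show m + 1 + k - 1 - m = k by omega, momentum, momentum]
  push_cast at hL ⊢
  field_simp
  ring

theorem phase_reflect {m : ℕ} (hm : m < L) : phase L (L - 1 - m) = (phase L m)⁻¹ := by
  rw [phase, phase, momentum_reflect hm, ← Complex.exp_neg]
  push_cast
  rw [sub_mul, sub_eq_neg_add, Complex.exp_periodic]

theorem phase_eq_mul_pow (hL : L ≠ 0) (m : ℕ) :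
    phase L m = Complex.exp (Real.pi / L * Complex.I) *
      Complex.exp (2 * Real.pi * Complex.I / L) ^ m := by
  have hL' : (L : ℂ) ≠ 0 := Nat.cast_ne_zero.2 hL
  rw [phase, momentum, ← Complex.exp_nat_mul, ← Complex.exp_add]
  congr 1
  push_cast
  field_simp
  ring

theorem phase_pow_card (hL : L ≠ 0) (m : ℕ) : phase L m ^ L = -1 := by
  have hL' : (L : ℂ) ≠ 0 := Nat.cast_ne_zero.2 hL
  rw [phase, momentum, ← Complex.exp_nat_mul, ← Complex.exp_pi_mul_I,
    Complex.exp_eq_exp_iff_exists_int]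
  refine ⟨m, ?_⟩
  push_cast
  field_simp
  ring

theorem sum_pow_mul_inv_pow_of_isPrimitiveRoot {K : Type*} [Field K] {ζ : K}
    (hζ : IsPrimitiveRoot ζ L) {i j : ℕ} (hi : i < L) (hj : j < L) :
    ∑ k ∈ Finset.range L, (ζ ^ i * (ζ ^ j)⁻¹) ^ k = if i = j then (L : K) else 0 := by
  have hζ0 : ζ ≠ 0 := hζ.ne_zero (by omega)
  split_ifs with hij
  · simp [hij, hζ0]
  · have hne : ζ ^ i * (ζ ^ j)⁻¹ ≠ 1 := fun h =>
      hij (hζ.pow_inj hi hj ((mul_inv_eq_one₀ (pow_ne_zero _ hζ0)).1 h))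
    have hpow : (ζ ^ i * (ζ ^ j)⁻¹) ^ L = 1 := by
      rw [mul_pow, inv_pow, pow_right_comm, pow_right_comm ζ j, hζ.pow_eq_one]
      simp
    have hgeom := mul_neg_geom_sum (ζ ^ i * (ζ ^ j)⁻¹) L
    rw [hpow, sub_self, mul_eq_zero] at hgeom
    exact hgeom.resolve_left (sub_ne_zero.2 hne.symm)

theorem sum_phase_site {m p : ℕ} (hm : m < L) (hp : p < L) :
    ∑ k ∈ Finset.range L, phase L m ^ k * (phase L p)⁻¹ ^ k = if m = p then (L : ℂ) else 0 := by
  rw [← sum_pow_mul_inv_pow_of_isPrimitiveRoot (Complex.isPrimitiveRoot_exp L (by omega)) hm hp]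
  refine Finset.sum_congr rfl fun k _ => ?_
  have := Complex.exp_ne_zero (Real.pi / L * Complex.I)
  rw [← mul_pow, phase_eq_mul_pow (by omega), phase_eq_mul_pow (by omega)]
  congr 1
  field_simp

theorem sum_phase_mode {j l : ℕ} (hj : j < L) (hl : l < L) :
    ∑ m ∈ Finset.range L, phase L m ^ j * (phase L m)⁻¹ ^ l = if j = l then (L : ℂ) else 0 := by
  set ξ := Complex.exp (Real.pi / L * Complex.I) with hξ
  set ζ := Complex.exp (2 * Real.pi * Complex.I / L) with hζ
  have hξ0 : ξ ≠ 0 := Complex.exp_ne_zero _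
  have hterm (m : ℕ) : phase L m ^ j * (phase L m)⁻¹ ^ l =
      (ξ ^ j * (ξ ^ l)⁻¹) * (ζ ^ j * (ζ ^ l)⁻¹) ^ m := by
    rw [phase_eq_mul_pow (by omega), ← hξ, ← hζ, inv_pow, mul_pow, mul_pow, mul_pow, inv_pow,
      mul_inv, pow_right_comm ζ m, pow_right_comm ζ m]
    ring
  simp_rw [hterm]
  rw [← Finset.mul_sum, sum_pow_mul_inv_pow_of_isPrimitiveRoot
    (Complex.isPrimitiveRoot_exp L (by omega)) hj hl]
  split_ifs with h
  · subst h
    field_simp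
  · rw [mul_zero]

theorem sum_phase_inv_mul_phase {m p : ℕ} (hm : m < L) (hp : p < L) :
    ∑ k ∈ Finset.range L, (phase L m)⁻¹ ^ k * phase L p ^ k = if p = m then (L : ℂ) else 0 := by
  simp_rw [mul_comm (_⁻¹ ^ _), sum_phase_site hp hm]

theorem sum_phase_mul_phase {m p : ℕ} (hm : m < L) (hp : p < L) :
    ∑ k ∈ Finset.range L, phase L m ^ k * phase L p ^ k =
      if p = L - 1 - m then (L : ℂ) else 0 := by
  rw [← sum_phase_inv_mul_phase (by omega) hp]
  simp_rw [phase_reflect hm, inv_inv]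

theorem sum_phase_inv_mul_phase_inv {m p : ℕ} (hm : m < L) (hp : p < L) :
    ∑ k ∈ Finset.range L, (phase L m)⁻¹ ^ k * (phase L p)⁻¹ ^ k =
      if p = L - 1 - m then (L : ℂ) else 0 := by
  simp_rw [← phase_reflect hm, sum_phase_site (by omega : L - 1 - m < L) hp, eq_comm]

theorem sum_smul_sum_of_orthogonal {R M : Type*} [CommSemiring R] [AddCommMonoid M] [Module R M]
    {x y : ℕ → ℕ → R} {r : R} {j : ℕ} (hj : j < L)
    (horth : ∀ l < L, ∑ m ∈ Finset.range L, x m j * y m l = if j = l then r else 0)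
    (X : ℕ → M) :
    ∑ m ∈ Finset.range L, x m j • ∑ l ∈ Finset.range L, y m l • X l = r • X j := by
  simp_rw [Finset.smul_sum, smul_smul]
  rw [Finset.sum_comm]
  simp_rw [← Finset.sum_smul]
  rw [Finset.sum_congr rfl fun l hl => by rw [horth l (Finset.mem_range.1 hl)]]
  simp [ite_smul, hj]

theorem sum_mul_sum_of_orthogonal {R A : Type*} [CommSemiring R] [Semiring A] [Algebra R A]
    {x y : ℕ → ℕ → R} {r : R} {τ : ℕ → ℕ} (hτ : ∀ m < L, τ m < L)
    (horth : ∀ m < L, ∀ p < L,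
      ∑ k ∈ Finset.range L, x m k * y p k = if p = τ m then r else 0) (X Y : ℕ → A) :
    ∑ k ∈ Finset.range L, (∑ m ∈ Finset.range L, x m k • X m) *
        (∑ p ∈ Finset.range L, y p k • Y p) =
      r • ∑ m ∈ Finset.range L, X m * Y (τ m) := by
  simp_rw [Finset.sum_mul_sum, smul_mul_smul_comm]
  rw [Finset.sum_comm, Finset.smul_sum]
  refine Finset.sum_congr rfl fun m hm => ?_
  have hm := Finset.mem_range.1 hm
  rw [Finset.sum_comm]
  simp_rw [← Finset.sum_smul]
  rw [Finset.sum_congr rfl fun p hp => by rw [horth m hm p (Finset.mem_range.1 hp)]]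
  simp [ite_smul, hτ m hm]

end Fourier

section CanonicalAnticommutation

theorem sum_smul_mul_sum_smul_anticomm {ι R A : Type*} [CommRing R] [Ring A] [Algebra R A]
    {s : Finset ι} {c : ι → A} (hc : ∀ i ∈ s, ∀ j ∈ s, c i * c j = -(c j * c i)) (x y : ι → R) :
    (∑ i ∈ s, x i • c i) * ∑ j ∈ s, y j • c j = -((∑ j ∈ s, y j • c j) * ∑ i ∈ s, x i • c i) := by
  simp_rw [Finset.sum_mul_sum, smul_mul_smul_comm, ← Finset.sum_neg_distrib]
  rw [Finset.sum_comm]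
  refine Finset.sum_congr rfl fun j hj => Finset.sum_congr rfl fun i hi => ?_
  rw [hc i hi j hj, smul_neg, mul_comm]

/-- The canonical anticommutation relations of `L` fermionic modes with annihilators `c` and
creators `d`, both indexed by the natural numbers below `L`. -/
structure IsCAR {A : Type*} [Ring A] (L : ℕ) (c d : ℕ → A) : Prop where
  annihilate_anticomm : ∀ i < L, ∀ j < L, c i * c j = -(c j * c i)
  create_anticomm : ∀ i < L, ∀ j < L, d i * d j = -(d j * d i)
  annihilate_mul_create : ∀ i < L, ∀ j < L, c i * d j = (if i = j then 1 else 0) - d j * c i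

variable {A : Type*} [Ring A] [Algebra ℂ A] (L : ℕ)

/-- The annihilator of a momentum mode. The normalization `1 / L` is put here and not in
`modeCreate`, so that no square roots occur. -/
noncomputable def modeAnnihilate (c : ℕ → A) (m : ℕ) : A :=
  (L : ℂ)⁻¹ • ∑ j ∈ Finset.range L, (phase L m)⁻¹ ^ j • c j

/-- The creator of a momentum mode. -/
noncomputable def modeCreate (d : ℕ → A) (m : ℕ) : A :=
  ∑ j ∈ Finset.range L, phase L m ^ j • d j

/-- The antiperiodic field whose momentum modes are the annihilators `C`. -/
noncomputable def annihilationField (C : ℕ → A) (j : ℕ) : A :=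
  ∑ m ∈ Finset.range L, phase L m ^ j • C m

/-- The antiperiodic field whose momentum modes are the creators `D`. -/
noncomputable def creationField (D : ℕ → A) (j : ℕ) : A :=
  (L : ℂ)⁻¹ • ∑ m ∈ Finset.range L, (phase L m)⁻¹ ^ j • D m

variable {L}

theorem annihilationField_modeAnnihilate (c : ℕ → A) {j : ℕ} (hj : j < L) :
    annihilationField L (modeAnnihilate L c) j = c j := by
  have hL : (L : ℂ) ≠ 0 := Nat.cast_ne_zero.2 (by omega)
  simp only [annihilationField, modeAnnihilate, smul_comm _ (L : ℂ)⁻¹, ← Finset.smul_sum]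
  rw [sum_smul_sum_of_orthogonal (x := fun m j => phase L m ^ j)
    (y := fun m l => (phase L m)⁻¹ ^ l) hj (fun l hl => sum_phase_mode hj hl), inv_smul_smul₀ hL]

theorem creationField_modeCreate (d : ℕ → A) {j : ℕ} (hj : j < L) :
    creationField L (modeCreate L d) j = d j := by
  have hL : (L : ℂ) ≠ 0 := Nat.cast_ne_zero.2 (by omega)
  simp only [creationField, modeCreate]
  rw [sum_smul_sum_of_orthogonal (x := fun m j => (phase L m)⁻¹ ^ j)
    (y := fun m l => phase L m ^ l) hj (fun l hl => ?_), inv_smul_smul₀ hL]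
  simp_rw [mul_comm (_⁻¹ ^ _), sum_phase_mode hl hj, eq_comm]

theorem annihilationField_card (hL : L ≠ 0) (C : ℕ → A) :
    annihilationField L C L = -annihilationField L C 0 := by
  simp [annihilationField, phase_pow_card hL]

theorem creationField_card (hL : L ≠ 0) (D : ℕ → A) :
    creationField L D L = -creationField L D 0 := by
  simp [creationField, phase_pow_card hL, inv_pow, inv_neg]

theorem modeAnnihilate_mul_modeCreate {c d : ℕ → A} (h : IsCAR L c d) {m p : ℕ} (hm : m < L)
    (hp : p < L) :
    modeAnnihilate L c m * modeCreate L d p =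
      (if m = p then 1 else 0) - modeCreate L d p * modeAnnihilate L c m := by
  have hL : (L : ℂ) ≠ 0 := Nat.cast_ne_zero.2 (by omega)
  have hsum : modeAnnihilate L c m * modeCreate L d p + modeCreate L d p * modeAnnihilate L c m =
      (L : ℂ)⁻¹ • ∑ i ∈ Finset.range L, ∑ j ∈ Finset.range L,
        ((phase L m)⁻¹ ^ i * phase L p ^ j) • (if i = j then 1 else 0) := by
    simp only [modeAnnihilate, modeCreate, smul_mul_assoc, mul_smul_comm, Finset.sum_mul_sum,
      ← smul_add]
    rw [Finset.sum_comm (s := Finset.range L) (t := Finset.range L)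
      (f := fun j i => (phase L m)⁻¹ ^ i • phase L p ^ j • (d j * c i))]
    simp_rw [← Finset.sum_add_distrib]
    congr 1
    refine Finset.sum_congr rfl fun i hi => Finset.sum_congr rfl fun j hj => ?_
    rw [h.annihilate_mul_create i (Finset.mem_range.1 hi) j (Finset.mem_range.1 hj)]
    module
  rw [eq_sub_iff_add_eq, hsum]
  simp only [smul_ite, smul_zero, Finset.sum_ite_eq]
  rw [Finset.sum_congr rfl fun i hi => if_pos hi, ← Finset.sum_smul,
    sum_phase_inv_mul_phase hm hp, smul_smul]
  rcases eq_or_ne m p with rfl | hne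
  · simp [hL]
  · simp [hne, hne.symm]

theorem IsCAR.fourier {c d : ℕ → A} (h : IsCAR L c d) :
    IsCAR L (modeAnnihilate L c) (modeCreate L d) where
  annihilate_anticomm m _ p _ := by
    rw [modeAnnihilate, modeAnnihilate, smul_mul_smul_comm, smul_mul_smul_comm,
      sum_smul_mul_sum_smul_anticomm fun i hi j hj =>
        h.annihilate_anticomm i (Finset.mem_range.1 hi) j (Finset.mem_range.1 hj), smul_neg]
  create_anticomm m _ p _ := sum_smul_mul_sum_smul_anticomm (fun i hi j hj =>
    h.create_anticomm i (Finset.mem_range.1 hi) j (Finset.mem_range.1 hj)) _ _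
  annihilate_mul_create m hm p hp := modeAnnihilate_mul_modeCreate h hm hp

theorem sum_creationField_mul_annihilationField (C D : ℕ → A) (a b : ℕ) :
    ∑ k ∈ Finset.range L, creationField L D (k + a) * annihilationField L C (k + b) =
      ∑ m ∈ Finset.range L, ((phase L m)⁻¹ ^ a * phase L m ^ b) • (D m * C m) := by
  rcases eq_or_ne L 0 with rfl | hL
  · simp
  have hL' : (L : ℂ) ≠ 0 := Nat.cast_ne_zero.2 hL
  simp only [creationField, annihilationField, pow_add, mul_smul, smul_mul_assoc,
    ← Finset.smul_sum]
  rw [sum_mul_sum_of_orthogonal (x := fun m k => (phase L m)⁻¹ ^ k) (y := fun p k => phase L p ^ k)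
    (τ := id) (fun m hm => hm) (fun m hm p hp => sum_phase_inv_mul_phase hm hp),
    inv_smul_smul₀ hL']
  simp_rw [id, smul_mul_assoc, mul_smul_comm]

theorem sum_creationField_mul_creationField_succ (D : ℕ → A) :
    ∑ k ∈ Finset.range L, creationField L D k * creationField L D (k + 1) =
      ∑ m ∈ Finset.range L, ((L : ℂ)⁻¹ * phase L m) • (D m * D (L - 1 - m)) := by
  rcases eq_or_ne L 0 with rfl | hL
  · simp
  have hL' : (L : ℂ) ≠ 0 := Nat.cast_ne_zero.2 hL
  simp only [creationField, pow_succ, mul_smul, smul_mul_smul_comm, ← Finset.smul_sum]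
  rw [sum_mul_sum_of_orthogonal (x := fun m k => (phase L m)⁻¹ ^ k)
    (y := fun p k => (phase L p)⁻¹ ^ k) (τ := fun m => L - 1 - m) (fun m hm => by omega)
    (fun m hm p hp => sum_phase_inv_mul_phase_inv hm hp), inv_smul_smul₀ hL']
  congr 1
  refine Finset.sum_congr rfl fun m hm => ?_
  rw [phase_reflect (Finset.mem_range.1 hm), inv_inv, mul_smul_comm]

theorem sum_annihilationField_mul_annihilationField_succ (C : ℕ → A) :
    ∑ k ∈ Finset.range L, annihilationField L C k * annihilationField L C (k + 1) =
      ∑ m ∈ Finset.range L, (L * (phase L m)⁻¹) • (C m * C (L - 1 - m)) := by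
  simp only [annihilationField, pow_succ, mul_smul]
  rw [sum_mul_sum_of_orthogonal (x := fun m k => phase L m ^ k) (y := fun p k => phase L p ^ k)
    (τ := fun m => L - 1 - m) (fun m hm => by omega)
    (fun m hm p hp => sum_phase_mul_phase hm hp), Finset.smul_sum]
  refine Finset.sum_congr rfl fun m hm => ?_
  rw [phase_reflect (Finset.mem_range.1 hm), mul_smul_comm]

/-- The fermionic form of the jump over the bond between two sites with annihilators `c`, `c'` and
creators `d`, `d'`. -/
def bondOperator (α a μ : ℂ) (c d c' d' : A) : A :=
  a • (d * c' + d' * c) + α • (d * d') - μ • (c * c')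

theorem bondOperator_neg_swap {α a μ : ℂ} {c d c' d' : A} (hc : c * c' = -(c' * c))
    (hd : d * d' = -(d' * d)) :
    bondOperator α a μ c' d' (-c) (-d) = bondOperator α (-a) μ c d c' d' := by
  simp only [bondOperator, neg_mul, mul_neg, hc, hd]
  module

/-- The quadratic operator that couples each mode only to itself and to the opposite mode. -/
def quadraticHamiltonian (L : ℕ) (a β γ : ℕ → ℂ) (C D : ℕ → A) : A :=
  ∑ m ∈ Finset.range L, (a m • (D m * C m) + β m • (D m * D (L - 1 - m)) -
    γ m • (C m * C (L - 1 - m)))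

theorem sum_bondOperator (α a μ : ℂ) (C D : ℕ → A) :
    ∑ k ∈ Finset.range L, bondOperator α a μ (annihilationField L C k) (creationField L D k)
      (annihilationField L C (k + 1)) (creationField L D (k + 1)) =
    quadraticHamiltonian L (fun m => a * (phase L m + (phase L m)⁻¹))
      (fun m => α / L * phase L m) (fun m => μ * L * (phase L m)⁻¹) C D := by
  have hforward := sum_creationField_mul_annihilationField (L := L) C D 0 1
  have hbackward := sum_creationField_mul_annihilationField (L := L) C D 1 0
  simp only [add_zero] at hforward hbackward
  simp only [bondOperator, Finset.sum_sub_distrib, Finset.sum_add_distrib, ← Finset.smul_sum]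
  rw [hforward, hbackward, sum_creationField_mul_creationField_succ,
    sum_annihilationField_mul_annihilationField_succ, ← Finset.sum_add_distrib, Finset.smul_sum,
    Finset.smul_sum, Finset.smul_sum, ← Finset.sum_add_distrib, ← Finset.sum_sub_distrib]
  refine Finset.sum_congr rfl fun m _ => ?_
  module

end CanonicalAnticommutation

section PairState

variable {V : Type*} [AddCommGroup V] [Module ℂ V] {L : ℕ} {C D : ℕ → Module.End ℂ V}

/-- The Bardeen–Cooper–Schrieffer state: the first `n` pairs of opposite modes of the state `v` are
filled with amplitudes `G`. -/
noncomputable def pairState (L : ℕ) (D : ℕ → Module.End ℂ V) (v : V) (G : ℕ → ℂ) : ℕ → V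
  | 0 => v
  | n + 1 => pairState L D v G n + G n • D n (D (L - 1 - n) (pairState L D v G n))

theorem IsCAR.annihilate_create_apply (h : IsCAR L C D) {m p : ℕ} (hm : m < L) (hp : p < L)
    (u : V) : C m (D p u) = (if m = p then u else 0) - D p (C m u) := by
  have := LinearMap.congr_fun (h.annihilate_mul_create m hm p hp) u
  split_ifs at this ⊢ <;> simpa using this

theorem IsCAR.create_create_apply (h : IsCAR L C D) {m p : ℕ} (hm : m < L) (hp : p < L) (u : V) :
    D m (D p u) = -D p (D m u) :=
  LinearMap.congr_fun (h.create_anticomm m hm p hp) u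

theorem IsCAR.create_create_self_apply (h : IsCAR L C D) {m : ℕ} (hm : m < L) (u : V) :
    D m (D m u) = 0 := by
  have htwo : (2 : ℂ) • D m (D m u) = 0 := by
    rw [two_smul]
    exact eq_neg_iff_add_eq_zero.1 (h.create_create_apply hm hm u)
  exact (smul_eq_zero.1 htwo).resolve_left two_ne_zero

theorem IsCAR.annihilate_pair_apply (h : IsCAR L C D) {m p r : ℕ} (hm : m < L) (hp : p < L)
    (hr : r < L) (u : V) :
    C m (D p (D r u)) =
      (if m = p then D r u else 0) - (if m = r then D p u else 0) + D p (D r (C m u)) := by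
  rw [h.annihilate_create_apply hm hp, h.annihilate_create_apply hm hr, map_sub,
    apply_ite (D p), map_zero]
  abel

theorem IsCAR.annihilate_pairState (h : IsCAR L C D) {v : V} (hv : ∀ m < L, C m v = 0)
    {G : ℕ → ℂ} (hG : ∀ m < L, G (L - 1 - m) = -G m) {n : ℕ} (hn : 2 * n ≤ L) {m : ℕ}
    (hm : m < L) :
    C m (pairState L D v G n) =
      (if m < n ∨ L - 1 - m < n then G m else 0) • D (L - 1 - m) (pairState L D v G n) := by
  induction n generalizing m with
  | zero => simp [pairState, hv m hm]
  | succ n ih =>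
    have ih := fun m (hm : m < L) => ih (by omega) hm
    rw [pairState]
    set u := pairState L D v G n
    have hn : n < L := by omega
    have hn' : L - 1 - n < L := by omega
    simp only [map_add, map_smul]
    rw [h.annihilate_pair_apply hm hn hn']
    have hCn : C n u = 0 := by rw [ih n hn, if_neg (by omega), zero_smul]
    have hCn' : C (L - 1 - n) u = 0 := by rw [ih _ hn', if_neg (by omega), zero_smul]
    by_cases hmn : m = n
    · subst hmn
      rw [hCn, if_pos rfl, if_neg (by omega), if_pos (by omega),
        h.create_create_apply hn' hn, h.create_create_self_apply hn']
      simp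
    by_cases hmn' : m = L - 1 - n
    · subst hmn'
      rw [hCn', if_pos rfl, if_neg (by omega), if_pos (by omega),
        show L - 1 - (L - 1 - n) = n by omega, h.create_create_self_apply hn, hG n hn]
      simp
    have hfilled : (m < n + 1 ∨ L - 1 - m < n + 1) ↔ (m < n ∨ L - 1 - m < n) := by omega
    rw [if_neg hmn, if_neg hmn', ih m hm]
    simp only [hfilled, map_smul]
    rw [h.create_create_apply (m := L - 1 - m) (by omega) hn,
      h.create_create_apply (m := L - 1 - m) (by omega) hn', map_neg]
    module

theorem IsCAR.annihilate_fullPairState (h : IsCAR L C D) {v : V} (hv : ∀ m < L, C m v = 0)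
    {G : ℕ → ℂ} (hG : ∀ m < L, G (L - 1 - m) = -G m) {m : ℕ} (hm : m < L) :
    C m (pairState L D v G (L / 2)) = G m • D (L - 1 - m) (pairState L D v G (L / 2)) := by
  rw [h.annihilate_pairState hv hG (by omega) hm]
  split_ifs with hpaired
  · rfl
  · have hG0 := hG m hm
    rw [show L - 1 - m = m by omega, self_eq_neg] at hG0
    rw [hG0]

theorem map_pairState_eq_self {P : Module.End ℂ V} (hP : ∀ m, P * D m = -(D m * P)) {v : V}
    (hv : P v = v) (G : ℕ → ℂ) (n : ℕ) : P (pairState L D v G n) = pairState L D v G n := by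
  have hP_apply (m : ℕ) (u : V) : P (D m u) = -D m (P u) := LinearMap.congr_fun (hP m) u
  induction n with
  | zero => exact hv
  | succ n ih => simp [pairState, hP_apply, ih]

theorem continuous_pairState [TopologicalSpace V] [IsTopologicalAddGroup V] [ContinuousSMul ℂ V]
    [T2Space V] [FiniteDimensional ℂ V] (D : ℕ → Module.End ℂ V) (v : V)
    {X : Type*} [TopologicalSpace X] {G : X → ℕ → ℂ} (hG : ∀ m, Continuous fun x => G x m)
    (n : ℕ) : Continuous fun x => pairState L D v (G x) n := by
  induction n with
  | zero => exact continuous_const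
  | succ n ih =>
    exact ih.add ((hG n).smul ((D n).continuous_of_finiteDimensional.comp
      ((D (L - 1 - n)).continuous_of_finiteDimensional.comp ih)))

theorem sum_range_eq_zero_of_reflect_neg {M : Type*} [AddCommGroup M] [Module ℂ M] {u : ℕ → M}
    (hu : ∀ m < L, u (L - 1 - m) = -u m) : ∑ m ∈ Finset.range L, u m = 0 := by
  have hneg : ∑ m ∈ Finset.range L, u m = -∑ m ∈ Finset.range L, u m := by
    conv_lhs => rw [← Finset.sum_range_reflect]
    rw [← Finset.sum_neg_distrib]
    exact Finset.sum_congr rfl fun m hm => hu m (Finset.mem_range.1 hm)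
  have htwo : (2 : ℂ) • ∑ m ∈ Finset.range L, u m = 0 := by
    rw [two_smul]
    exact eq_neg_iff_add_eq_zero.1 hneg
  exact (smul_eq_zero.1 htwo).resolve_left two_ne_zero

/-- The coefficients of the two-particle terms only have to be symmetric, because opposite creators
anticommute. -/
theorem quadraticHamiltonian_apply_of_paired (h : IsCAR L C D) {a β γ G : ℕ → ℂ} {v : V}
    (hC : ∀ m < L, C m v = G m • D (L - 1 - m) v) (hG : ∀ m < L, G (L - 1 - m) = -G m)
    (hriccati : ∀ m < L, a m * G m + β m - γ m * G m ^ 2 =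
      a (L - 1 - m) * G (L - 1 - m) + β (L - 1 - m) - γ (L - 1 - m) * G (L - 1 - m) ^ 2) :
    quadraticHamiltonian L a β γ C D v = (∑ m ∈ Finset.range L, γ m * G m) • v := by
  have hmode : ∀ m < L, (a m • (D m * C m) + β m • (D m * D (L - 1 - m)) -
      γ m • (C m * C (L - 1 - m))) v = (γ m * G m) • v +
      (a m * G m + β m - γ m * G m ^ 2) • D m (D (L - 1 - m) v) := by
    intro m hm
    have hCD := h.annihilate_create_apply hm hm v
    rw [if_pos rfl, hC m hm, map_smul] at hCD
    have hC' : C (L - 1 - m) v = -G m • D m v := by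
      rw [hC _ (by omega), hG m hm, show L - 1 - (L - 1 - m) = m by omega]
    simp only [LinearMap.sub_apply, LinearMap.add_apply, LinearMap.smul_apply,
      Module.End.mul_apply, hC', hC m hm, map_smul, hCD]
    module
  rw [quadraticHamiltonian, LinearMap.sum_apply,
    Finset.sum_congr rfl fun m hm => hmode m (Finset.mem_range.1 hm),
    Finset.sum_add_distrib, ← Finset.sum_smul, add_eq_left]
  refine sum_range_eq_zero_of_reflect_neg fun m hm => ?_
  rw [← hriccati m hm, show L - 1 - (L - 1 - m) = m by omega,
    h.create_create_apply (by omega) hm, smul_neg]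

end PairState

section JordanWigner

variable {L : ℕ}

/-- The configuration with the occupation of the single site `j` changed. -/
def flipSite (j : ℕ) (η : Config L) : Config L := Function.update η (j : ZMod L) (!η (j : ZMod L))

/-- The parity of the occupation of the site `j`, as a sign. -/
def siteSign (j : ℕ) (η : Config L) : ℂ := if η (j : ZMod L) then -1 else 1

/-- The Jordan–Wigner string: the parity of the number of particles at the sites before `j`. -/
def stringSign (j : ℕ) (η : Config L) : ℂ := ∏ i ∈ Finset.range j, siteSign i η

/-- The lattice fermions: `fermion j true` creates and `fermion j false` annihilates a particle
at the site `j`. -/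
def fermion (j : ℕ) (b : Bool) : Module.End ℂ (Config L → ℂ) where
  toFun f η := if η (j : ZMod L) = b then stringSign j η * f (flipSite j η) else 0
  map_add' f g := by ext η; by_cases h : η (j : ZMod L) = b <;> simp [h, mul_add]
  map_smul' r f := by ext η; by_cases h : η (j : ZMod L) = b <;> simp [h, mul_left_comm]

/-- The total fermion parity. Its eigenvectors of eigenvalue `1` are the functions supported in the
even sector. -/
def parity (L : ℕ) : Module.End ℂ (Config L → ℂ) := LinearMap.mulLeft ℂ (stringSign L)

theorem fermion_apply (j : ℕ) (b : Bool) (f : Config L → ℂ) (η : Config L) :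
    fermion j b f η = if η (j : ZMod L) = b then stringSign j η * f (flipSite j η) else 0 := rfl

theorem parity_apply (f : Config L → ℂ) (η : Config L) :
    parity L f η = stringSign L η * f η := rfl

theorem siteSign_mul_self (j : ℕ) (η : Config L) : siteSign j η * siteSign j η = 1 := by
  unfold siteSign; split_ifs <;> norm_num

theorem stringSign_mul_self (j : ℕ) (η : Config L) : stringSign j η * stringSign j η = 1 := by
  rw [stringSign, ← Finset.prod_mul_distrib]
  exact Finset.prod_eq_one fun i _ => siteSign_mul_self i η

theorem stringSign_zero (η : Config L) : stringSign 0 η = 1 := Finset.prod_range_zero _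

theorem stringSign_succ (j : ℕ) (η : Config L) :
    stringSign (j + 1) η = stringSign j η * siteSign j η := Finset.prod_range_succ _ _

theorem stringSign_eq_neg_one_pow (j : ℕ) (η : Config L) :
    stringSign j η = (-1) ^ (∑ k ∈ Finset.range j, (η (k : ZMod L)).toNat) := by
  rw [stringSign, ← Finset.prod_pow_eq_pow_sum]
  refine Finset.prod_congr rfl fun k _ => ?_
  unfold siteSign
  cases η (k : ZMod L) <;> simp

theorem isEven_iff_stringSign (η : Config L) : IsEven η ↔ stringSign L η = 1 := by
  rw [stringSign_eq_neg_one_pow, IsEven, neg_one_pow_eq_one_iff_even (by norm_num)]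

theorem flipSite_apply_self (j : ℕ) (η : Config L) :
    flipSite j η (j : ZMod L) = !η (j : ZMod L) := by simp [flipSite]

theorem flipSite_flipSite (j : ℕ) (η : Config L) : flipSite j (flipSite j η) = η := by
  simp [flipSite]

theorem natCast_ne_natCast_of_lt {i j : ℕ} (hi : i < L) (hj : j < L) (hij : i ≠ j) :
    (i : ZMod L) ≠ (j : ZMod L) := by
  rwa [Ne, ZMod.natCast_eq_natCast_iff', Nat.mod_eq_of_lt hi, Nat.mod_eq_of_lt hj]

theorem flipSite_apply_of_ne {i j : ℕ} (hi : i < L) (hj : j < L) (hij : i ≠ j) (η : Config L) :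
    flipSite i η (j : ZMod L) = η (j : ZMod L) :=
  Function.update_of_ne (natCast_ne_natCast_of_lt hj hi hij.symm) _ _

theorem flipSite_comm {i j : ℕ} (hi : i < L) (hj : j < L) (hij : i ≠ j) (η : Config L) :
    flipSite i (flipSite j η) = flipSite j (flipSite i η) := by
  rw [flipSite, flipSite_apply_of_ne hj hi hij.symm η, flipSite, flipSite,
    flipSite_apply_of_ne hi hj hij η, flipSite,
    Function.update_comm (natCast_ne_natCast_of_lt hj hi hij.symm)]

theorem siteSign_flipSite_self (j : ℕ) (η : Config L) :
    siteSign j (flipSite j η) = -siteSign j η := by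
  rw [siteSign, siteSign, flipSite_apply_self]
  cases η (j : ZMod L) <;> simp

theorem siteSign_flipSite_of_ne {i j : ℕ} (hi : i < L) (hj : j < L) (hij : i ≠ j) (η : Config L) :
    siteSign j (flipSite i η) = siteSign j η := by
  rw [siteSign, siteSign, flipSite_apply_of_ne hi hj hij]

theorem stringSign_flipSite_of_le {i j : ℕ} (hi : i < L) (hji : j ≤ i) (η : Config L) :
    stringSign j (flipSite i η) = stringSign j η := by
  refine Finset.prod_congr rfl fun k hk => ?_
  have hk := Finset.mem_range.1 hk
  exact siteSign_flipSite_of_ne hi (by omega) (by omega) η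

theorem stringSign_flipSite_of_lt {i j : ℕ} (hj : j ≤ L) (hij : i < j) (η : Config L) :
    stringSign j (flipSite i η) = -stringSign j η := by
  have hi : i ∈ Finset.range j := Finset.mem_range.2 hij
  rw [stringSign, stringSign, ← Finset.mul_prod_erase _ _ hi, ← Finset.mul_prod_erase _ _ hi,
    siteSign_flipSite_self, neg_mul]
  congr 2
  refine Finset.prod_congr rfl fun k hk => ?_
  have hki := Finset.ne_of_mem_erase hk
  have hkj := Finset.mem_range.1 (Finset.mem_of_mem_erase hk)
  exact siteSign_flipSite_of_ne (by omega) (by omega) hki.symm η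

theorem fermion_mul_fermion_apply {i j : ℕ} (hij : i < j) (hj : j < L) (b b' : Bool)
    (f : Config L → ℂ) (η : Config L) :
    (fermion i b * fermion j b' : Module.End ℂ (Config L → ℂ)) f η =
      if η (i : ZMod L) = b ∧ η (j : ZMod L) = b' then
        -(stringSign i η * stringSign j η * f (flipSite i (flipSite j η))) else 0 := by
  have hi : i < L := hij.trans hj
  simp only [Module.End.mul_apply, fermion_apply, flipSite_apply_of_ne hi hj hij.ne,
    stringSign_flipSite_of_lt hj.le hij, flipSite_comm hj hi hij.ne', ite_and]
  split_ifs <;> ring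

theorem fermion_anticomm_of_lt {i j : ℕ} (hij : i < j) (hj : j < L) (b b' : Bool) :
    (fermion i b : Module.End ℂ (Config L → ℂ)) * fermion j b' =
      -(fermion j b' * fermion i b) := by
  ext f η
  have hi : i < L := hij.trans hj
  rw [fermion_mul_fermion_apply hij hj, LinearMap.neg_apply, Pi.neg_apply]
  simp only [Module.End.mul_apply, fermion_apply, flipSite_apply_of_ne hj hi hij.ne',
    stringSign_flipSite_of_le hj hij.le, ite_and]
  split_ifs <;> ring

theorem fermion_anticomm {i j : ℕ} (hi : i < L) (hj : j < L) (hij : i ≠ j) (b b' : Bool) :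
    (fermion i b : Module.End ℂ (Config L → ℂ)) * fermion j b' =
      -(fermion j b' * fermion i b) := by
  rcases lt_or_gt_of_ne hij with h | h
  · exact fermion_anticomm_of_lt h hj b b'
  · rw [fermion_anticomm_of_lt h hi b' b, neg_neg]

theorem fermion_mul_self (j : ℕ) (b : Bool) :
    (fermion j b : Module.End ℂ (Config L → ℂ)) * fermion j b = 0 := by
  ext f η
  simp only [Module.End.mul_apply, fermion_apply, flipSite_apply_self]
  split_ifs <;> simp_all

theorem fermion_anticomm_same (b : Bool) {i j : ℕ} (hi : i < L) (hj : j < L) :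
    (fermion i b : Module.End ℂ (Config L → ℂ)) * fermion j b =
      -(fermion j b * fermion i b) := by
  rcases eq_or_ne i j with rfl | h
  · simp [fermion_mul_self]
  · exact fermion_anticomm hi hj h b b

theorem fermion_false_mul_fermion_true {i j : ℕ} (hi : i < L) (hj : j < L) :
    (fermion i false : Module.End ℂ (Config L → ℂ)) * fermion j true =
      (if i = j then 1 else 0) - fermion j true * fermion i false := by
  rcases eq_or_ne i j with rfl | h
  · rw [if_pos rfl]
    ext f η
    simp only [Module.End.mul_apply, fermion_apply, flipSite_apply_self, LinearMap.sub_apply,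
      Pi.sub_apply, stringSign_flipSite_of_le hi le_rfl, flipSite_flipSite, Module.End.one_apply]
    cases η (i : ZMod L) <;> simp [← mul_assoc, stringSign_mul_self i η]
  · rw [if_neg h, zero_sub]
    exact fermion_anticomm hi hj h _ _

theorem isCAR_fermion (L : ℕ) :
    IsCAR L (fun j => (fermion j false : Module.End ℂ (Config L → ℂ)))
      (fun j => fermion j true) where
  annihilate_anticomm _ hi _ hj := fermion_anticomm_same false hi hj
  create_anticomm _ hi _ hj := fermion_anticomm_same true hi hj
  annihilate_mul_create _ hi _ hj := fermion_false_mul_fermion_true hi hj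

theorem fermion_true_mul_fermion_false_apply {k : ℕ} (hk : k < L) (f : Config L → ℂ)
    (η : Config L) :
    (fermion k true * fermion k false : Module.End ℂ (Config L → ℂ)) f η =
      occ η (k : ZMod L) * f η := by
  simp only [Module.End.mul_apply, fermion_apply, flipSite_apply_self,
    stringSign_flipSite_of_le hk le_rfl, flipSite_flipSite, occ]
  cases η (k : ZMod L) <;> simp [← mul_assoc, stringSign_mul_self k η]

theorem parity_mul_fermion {j : ℕ} (hj : j < L) (b : Bool) :
    parity L * fermion j b = -(fermion j b * parity L) := by
  ext f η
  simp only [Module.End.mul_apply, LinearMap.neg_apply, Pi.neg_apply, parity_apply, fermion_apply,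
    stringSign_flipSite_of_lt le_rfl hj]
  split_ifs <;> ring

theorem flip_eq_flipSite {k j : ℕ} (hkL : k < L) (hjL : j < L) (hkj : k ≠ j)
    (hsucc : (k : ZMod L) + 1 = j) (η : Config L) :
    flip η (k : ZMod L) = flipSite k (flipSite j η) := by
  have hne := natCast_ne_natCast_of_lt hkL hjL hkj
  ext l
  simp only [flip, flipSite, Function.update_apply, hsucc]
  by_cases hk : l = (k : ZMod L)
  · simp [hk, hne]
  · by_cases hj : l = (j : ZMod L)
    · simp [hj, hne.symm]
    · simp [hk, hj]

theorem flip_eq_of_lt {k : ℕ} (hk : k + 1 < L) (η : Config L) :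
    flip η (k : ZMod L) = flipSite k (flipSite (k + 1) η) :=
  flip_eq_flipSite (by omega) hk (by omega) (by push_cast; rfl) η

theorem natCast_add_one_eq_zero {n : ℕ} (hL : L = n + 1) :
    (n : ZMod L) + 1 = ((0 : ℕ) : ZMod L) := by
  subst hL
  exact_mod_cast ZMod.natCast_self (n + 1)

theorem flip_last {n : ℕ} (hL : L = n + 1) (hn : 0 < n) (η : Config L) :
    flip η (n : ZMod L) = flipSite 0 (flipSite n η) := by
  rw [flip_eq_flipSite (by omega) (by omega) hn.ne' (natCast_add_one_eq_zero hL),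
    flipSite_comm (by omega) (by omega) hn.ne']

theorem stringSign_flip {k : ℕ} (hL : 2 ≤ L) (hk : k < L) (η : Config L) :
    stringSign L (flip η (k : ZMod L)) = stringSign L η := by
  rcases Nat.lt_or_ge (k + 1) L with h | h
  · rw [flip_eq_of_lt h, stringSign_flipSite_of_lt le_rfl hk, stringSign_flipSite_of_lt le_rfl h,
      neg_neg]
  · obtain rfl : L = k + 1 := by omega
    rw [flip_last rfl (by omega), stringSign_flipSite_of_lt le_rfl (by omega),
      stringSign_flipSite_of_lt le_rfl hk, neg_neg]

theorem isEven_flip {k : ℕ} (hL : 2 ≤ L) (hk : k < L) {η : Config L} (hη : IsEven η) :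
    IsEven (flip η (k : ZMod L)) := by
  rw [isEven_iff_stringSign] at *
  rw [stringSign_flip hL hk, hη]

theorem bondOperator_fermion_apply {i j : ℕ} (hij : i < j) (hj : j < L) (α a μ : ℂ)
    (f : Config L → ℂ) (η : Config L) :
    bondOperator α a μ (fermion i false) (fermion i true) (fermion j false) (fermion j true) f η =
      (if η (i : ZMod L) then (if η (j : ZMod L) then -α else -a)
        else if η (j : ZMod L) then a else μ) *
      (stringSign i η * stringSign j η * f (flipSite i (flipSite j η))) := by
  rw [bondOperator, ← neg_eq_iff_eq_neg.2 (fermion_anticomm_of_lt hij hj false true)]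
  simp only [LinearMap.sub_apply, LinearMap.add_apply, LinearMap.smul_apply, LinearMap.neg_apply,
    Pi.sub_apply, Pi.add_apply, Pi.smul_apply, Pi.neg_apply, smul_eq_mul,
    fermion_mul_fermion_apply hij hj]
  cases η (i : ZMod L) <;> cases η (j : ZMod L) <;> simp

theorem bondOperator_apply_of_lt {k : ℕ} (hk : k + 1 < L) (w μ x : ℂ) (f : Config L → ℂ)
    (η : Config L) :
    bondOperator (μ + 2 * w * x) (μ + w * x) μ (fermion k false) (fermion k true)
      (fermion (k + 1) false) (fermion (k + 1) true) f η =
    (μ + w * x * (occ η k + occ η (k + 1))) * f (flip η (k : ZMod L)) := by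
  rw [bondOperator_fermion_apply (Nat.lt_succ_self k) hk, ← flip_eq_of_lt hk, stringSign_succ,
    ← mul_assoc (stringSign k η), stringSign_mul_self, one_mul, siteSign, occ, occ]
  push_cast
  cases η (k : ZMod L) <;> cases η ((k : ZMod L) + 1) <;>
    simp only [Bool.false_eq_true, ↓reduceIte, Bool.toNat_true,
      Bool.toNat_false, Nat.cast_one, Nat.cast_zero] <;>
    ring

/-- The total parity of an even function turns the periodic boundary condition of the spins into the
antiperiodic one of the fermions. -/
theorem bondOperator_apply_last {n : ℕ} (hL : L = n + 1) (hn : 0 < n) (w μ x : ℂ)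
    {f : Config L → ℂ} (hf : parity L f = f) (η : Config L) :
    bondOperator (μ + 2 * w * x) (μ + w * x) μ (fermion n false) (fermion n true)
      (-fermion 0 false) (-fermion 0 true) f η =
    (μ + w * x * (occ η n + occ η (n + 1))) * f (flip η (n : ZMod L)) := by
  have hnL : n < L := by omega
  have hswap : bondOperator (μ + 2 * w * x) (μ + w * x) μ (fermion n false) (fermion n true)
      (-fermion 0 false) (-fermion 0 true) =
      bondOperator (μ + 2 * w * x) (-(μ + w * x)) μ (fermion 0 false) (fermion 0 true)
        (fermion n false) (fermion n true : Module.End ℂ (Config L → ℂ)) :=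
    bondOperator_neg_swap (fermion_anticomm_of_lt hn hnL false false)
      (fermion_anticomm_of_lt hn hnL true true)
  have hstring : stringSign n η * f (flip η (n : ZMod L)) =
      siteSign n η * f (flip η (n : ZMod L)) := by
    have hfη := congrFun hf (flip η (n : ZMod L))
    rw [parity_apply, stringSign_flip (by omega) hnL] at hfη
    have hLn : stringSign L η = stringSign n η * siteSign n η := by
      subst hL
      exact stringSign_succ n η
    rw [hLn] at hfη
    linear_combination siteSign n η * hfη -
      stringSign n η * f (flip η (n : ZMod L)) * siteSign_mul_self n η
  rw [hswap, bondOperator_fermion_apply hn hnL, ← flip_last hL hn, stringSign_zero, one_mul,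
    hstring, siteSign, occ, occ, natCast_add_one_eq_zero hL]
  cases η (n : ZMod L) <;> cases η ((0 : ℕ) : ZMod L) <;>
    simp only [Bool.false_eq_true, ↓reduceIte, Bool.toNat_true,
      Bool.toNat_false, Nat.cast_one, Nat.cast_zero, Complex.ofReal_one, Complex.ofReal_zero] <;>
    ring

end JordanWigner

section TiltedGenerator

/-- The generator of the configuration process tilted by the weight `x` per particle jump, on
functions with values in a real vector space. The tilt `x = exp s` belongs to the moment generating
function of the activity at `s`. -/
def tiltedGenerator (E : Type*) [AddCommGroup E] [Module ℝ E] (w μ x : ℝ) (L : ℕ) :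
    Module.End ℝ (Config L → E) where
  toFun f η := ∑ k ∈ Finset.range L,
    ((μ + w * x * (occ η (k : ZMod L) + occ η ((k : ZMod L) + 1))) • f (flip η (k : ZMod L))
      - (μ + w * (occ η (k : ZMod L) + occ η ((k : ZMod L) + 1))) • f η)
  map_add' f g := by
    ext η
    refine Eq.trans (Finset.sum_congr rfl fun k _ => ?_) Finset.sum_add_distrib
    simp only [Pi.add_apply]
    module
  map_smul' r f := by
    ext η
    refine Eq.trans (Finset.sum_congr rfl fun k _ => ?_) (Finset.smul_sum (r := r)).symm
    simp only [Pi.smul_apply]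
    module

variable {L : ℕ}

theorem tiltedGenerator_apply {E : Type*} [AddCommGroup E] [Module ℝ E] (w μ x : ℝ)
    (f : Config L → E) (η : Config L) :
    tiltedGenerator E w μ x L f η = ∑ k ∈ Finset.range L,
      ((μ + w * x * (occ η (k : ZMod L) + occ η ((k : ZMod L) + 1))) • f (flip η (k : ZMod L))
        - (μ + w * (occ η (k : ZMod L) + occ η ((k : ZMod L) + 1))) • f η) := rfl

theorem tiltedGenerator_comp {E F : Type*} [AddCommGroup E] [Module ℝ E] [AddCommGroup F]
    [Module ℝ F] (w μ x : ℝ) (T : E →ₗ[ℝ] F) (f : Config L → E) :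
    tiltedGenerator F w μ x L (T ∘ f) = T ∘ tiltedGenerator E w μ x L f := by
  ext η
  simp [tiltedGenerator_apply, map_sum]

/-- The annihilator of an antiperiodic momentum mode of the lattice fermions. -/
noncomputable def momentumAnnihilator (L m : ℕ) : Module.End ℂ (Config L → ℂ) :=
  modeAnnihilate L (fun j => fermion j false) m

/-- The creator of an antiperiodic momentum mode of the lattice fermions. -/
noncomputable def momentumCreator (L m : ℕ) : Module.End ℂ (Config L → ℂ) :=
  modeCreate L (fun j => fermion j true) m

/-- The indicator function of the empty configuration, the vacuum of the lattice fermions. -/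
noncomputable def vacuum (L : ℕ) : Config L → ℂ := Set.indicator {fun _ => false} 1

theorem isCAR_momentum (L : ℕ) : IsCAR L (momentumAnnihilator L) (momentumCreator L) :=
  (isCAR_fermion L).fourier

theorem momentumAnnihilator_vacuum (m : ℕ) : momentumAnnihilator L m (vacuum L) = 0 := by
  have hfermion (j : ℕ) : fermion j false (vacuum L) = 0 := by
    ext η
    rw [fermion_apply]
    split_ifs with hj
    · rw [vacuum, Set.indicator_of_notMem, mul_zero, Pi.zero_apply]
      rintro hempty
      simpa [flipSite_apply_self, hj] using congrFun hempty (j : ZMod L)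
    · rfl
  simp [momentumAnnihilator, modeAnnihilate, hfermion]

theorem momentumCreator_apply_empty (m : ℕ) (f : Config L → ℂ) :
    momentumCreator L m f (fun _ => false) = 0 := by
  simp [momentumCreator, modeCreate, LinearMap.sum_apply, Finset.sum_apply, fermion_apply]

theorem parity_vacuum : parity L (vacuum L) = vacuum L := by
  ext η
  by_cases hempty : η = fun _ => false
  · simp [hempty, parity_apply, stringSign, siteSign]
  · simp [parity_apply, vacuum, hempty]

theorem parity_mul_momentumCreator (m : ℕ) :
    parity L * momentumCreator L m = -(momentumCreator L m * parity L) := by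
  simp only [momentumCreator, modeCreate, Finset.mul_sum, Finset.sum_mul, mul_smul_comm,
    smul_mul_assoc]
  rw [← Finset.sum_neg_distrib]
  refine Finset.sum_congr rfl fun j hj => ?_
  rw [parity_mul_fermion (Finset.mem_range.1 hj), smul_neg]

theorem annihilationField_momentumAnnihilator {j : ℕ} (hj : j < L) :
    annihilationField L (momentumAnnihilator L) j = fermion j false :=
  annihilationField_modeAnnihilate _ hj

theorem creationField_momentumCreator {j : ℕ} (hj : j < L) :
    creationField L (momentumCreator L) j = fermion j true :=
  creationField_modeCreate _ hj

theorem sum_flip_eq_sum_bondOperator (hL : 2 ≤ L) (w μ x : ℂ) {f : Config L → ℂ}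
    (hf : parity L f = f) (η : Config L) :
    ∑ k ∈ Finset.range L,
      (μ + w * x * (occ η (k : ZMod L) + occ η ((k : ZMod L) + 1))) * f (flip η (k : ZMod L)) =
    (∑ k ∈ Finset.range L, bondOperator (μ + 2 * w * x) (μ + w * x) μ
      (annihilationField L (momentumAnnihilator L) k) (creationField L (momentumCreator L) k)
      (annihilationField L (momentumAnnihilator L) (k + 1))
      (creationField L (momentumCreator L) (k + 1))) f η := by
  rw [LinearMap.sum_apply, Finset.sum_apply]
  refine Finset.sum_congr rfl fun k hk => ?_
  have hk := Finset.mem_range.1 hk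
  rw [annihilationField_momentumAnnihilator hk, creationField_momentumCreator hk]
  rcases Nat.lt_or_ge (k + 1) L with hk' | hk'
  · rw [annihilationField_momentumAnnihilator hk', creationField_momentumCreator hk',
      bondOperator_apply_of_lt hk']
  · have hkL : k + 1 = L := by omega
    rw [hkL, annihilationField_card (by omega), creationField_card (by omega),
      annihilationField_momentumAnnihilator (by omega), creationField_momentumCreator (by omega)]
    exact (bondOperator_apply_last hkL.symm (by omega) w μ x hf η).symm

theorem sum_occ_succ (η : Config L) :
    ∑ k ∈ Finset.range L, occ η ((k : ZMod L) + 1) = ∑ k ∈ Finset.range L, occ η (k : ZMod L) := by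
  have hshift := Finset.sum_range_succ (fun k : ℕ => occ η (k : ZMod L)) L
  rw [Finset.sum_range_succ'] at hshift
  push_cast [ZMod.natCast_self] at hshift
  exact add_right_cancel hshift

theorem sum_momentumCreator_mul_momentumAnnihilator_apply (f : Config L → ℂ) (η : Config L) :
    (∑ m ∈ Finset.range L, momentumCreator L m * momentumAnnihilator L m) f η =
      (∑ k ∈ Finset.range L, occ η (k : ZMod L) : ℝ) * f η := by
  have hsite := sum_creationField_mul_annihilationField (L := L) (momentumAnnihilator L)
    (momentumCreator L) 0 0
  simp only [add_zero, pow_zero, mul_one, one_smul] at hsite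
  rw [← hsite, LinearMap.sum_apply, Finset.sum_apply, Complex.ofReal_sum, Finset.sum_mul]
  refine Finset.sum_congr rfl fun k hk => ?_
  have hk := Finset.mem_range.1 hk
  rw [creationField_momentumCreator hk, annihilationField_momentumAnnihilator hk,
    fermion_true_mul_fermion_false_apply hk]

end TiltedGenerator

section Spectrum

/-- The diagonal coefficient of a momentum mode in the tilted generator. -/
noncomputable def modeDiagonal (w μ x : ℝ) (L m : ℕ) : ℝ :=
  2 * (μ + w * x) * Real.cos (momentum L m) - 2 * w

/-- The discriminant of the Riccati equation `pairRatio_riccati` of a pair of opposite modes. -/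
noncomputable def modeDiscriminant (w μ x : ℝ) (L m : ℕ) : ℝ :=
  modeDiagonal w μ x L m ^ 2 + 4 * (μ + 2 * w * x) * μ * Real.sin (momentum L m) ^ 2

/-- The amplitude of a pair of opposite modes in the dominant eigenvector, rescaled so as to be
real. For the unpaired mode of momentum `π` it is `0` by the convention `a / 0 = 0`. -/
noncomputable def pairRatio (w μ x : ℝ) (L m : ℕ) : ℝ :=
  -(modeDiagonal w μ x L m + √(modeDiscriminant w μ x L m)) / (2 * μ * Real.sin (momentum L m))

/-- The amplitude of a pair of opposite modes in the dominant eigenvector. -/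
noncomputable def pairAmplitude (w μ x : ℝ) (L m : ℕ) : ℂ :=
  -Complex.I * pairRatio w μ x L m / L

/-- The dominant eigenvalue of the tilted generator in the even sector. -/
noncomputable def topEigenvalue (w μ x : ℝ) (L : ℕ) : ℝ :=
  -(μ + w) * L + (∑ m ∈ Finset.range L, √(modeDiscriminant w μ x L m)) / 2

/-- The dominant eigenvector of the tilted generator in the even sector. -/
noncomputable def topVector (w μ x : ℝ) (L : ℕ) : Config L → ℂ :=
  pairState L (momentumCreator L) (vacuum L) (pairAmplitude w μ x L) (L / 2)

variable {L : ℕ}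

theorem phase_eq_cos_add_sin (L m : ℕ) :
    phase L m = Real.cos (momentum L m) + Real.sin (momentum L m) * Complex.I := by
  rw [phase, Complex.exp_mul_I, Complex.ofReal_cos, Complex.ofReal_sin]

theorem phase_inv_eq_cos_sub_sin (L m : ℕ) :
    (phase L m)⁻¹ = Real.cos (momentum L m) - Real.sin (momentum L m) * Complex.I := by
  rw [phase, ← Complex.exp_neg, ← neg_mul, Complex.exp_mul_I, Complex.cos_neg, Complex.sin_neg,
    Complex.ofReal_cos, Complex.ofReal_sin, neg_mul, sub_eq_add_neg]

theorem cos_momentum_reflect {m : ℕ} (hm : m < L) :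
    Real.cos (momentum L (L - 1 - m)) = Real.cos (momentum L m) := by
  rw [momentum_reflect hm, Real.cos_two_pi_sub]

theorem sin_momentum_reflect {m : ℕ} (hm : m < L) :
    Real.sin (momentum L (L - 1 - m)) = -Real.sin (momentum L m) := by
  rw [momentum_reflect hm, Real.sin_two_pi_sub]

theorem cos_momentum_eq_neg_one_of_sin_eq_zero (hL : L ≠ 0) {m : ℕ}
    (hsin : Real.sin (momentum L m) = 0) : Real.cos (momentum L m) = -1 := by
  refine (Real.sin_eq_zero_iff_cos_eq.1 hsin).resolve_left fun hcos => ?_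
  have hpow := phase_pow_card hL m
  rw [phase_eq_cos_add_sin, hcos, hsin] at hpow
  norm_num at hpow

theorem sum_cos_momentum (hL : 2 ≤ L) : ∑ m ∈ Finset.range L, Real.cos (momentum L m) = 0 := by
  have hsum := sum_phase_mode (by omega : 1 < L) (by omega : 0 < L)
  simp only [pow_one, pow_zero, mul_one, one_ne_zero, if_false] at hsum
  simpa [phase_eq_cos_add_sin, Complex.cos_ofReal_re] using congrArg Complex.re hsum

variable {w μ x : ℝ}

theorem modeDiagonal_eq_phase (w μ x : ℝ) (L m : ℕ) :
    (modeDiagonal w μ x L m : ℂ) = (μ + w * x) * (phase L m + (phase L m)⁻¹) - 2 * w := by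
  rw [phase_inv_eq_cos_sub_sin, phase_eq_cos_add_sin, modeDiagonal]
  push_cast
  ring

theorem sum_modeDiagonal (w μ x : ℝ) (hL : 2 ≤ L) :
    ∑ m ∈ Finset.range L, modeDiagonal w μ x L m = -2 * w * L := by
  simp only [modeDiagonal]
  rw [Finset.sum_sub_distrib, ← Finset.mul_sum, sum_cos_momentum hL, Finset.sum_const,
    Finset.card_range, nsmul_eq_mul]
  ring

theorem modeDiagonal_reflect {m : ℕ} (hm : m < L) :
    modeDiagonal w μ x L (L - 1 - m) = modeDiagonal w μ x L m := by
  rw [modeDiagonal, modeDiagonal, cos_momentum_reflect hm]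

theorem modeDiscriminant_reflect {m : ℕ} (hm : m < L) :
    modeDiscriminant w μ x L (L - 1 - m) = modeDiscriminant w μ x L m := by
  rw [modeDiscriminant, modeDiscriminant, modeDiagonal_reflect hm, sin_momentum_reflect hm, neg_sq]

theorem pairRatio_reflect {m : ℕ} (hm : m < L) :
    pairRatio w μ x L (L - 1 - m) = -pairRatio w μ x L m := by
  rw [pairRatio, pairRatio, modeDiagonal_reflect hm, modeDiscriminant_reflect hm,
    sin_momentum_reflect hm, mul_neg, div_neg]

theorem pairAmplitude_reflect {m : ℕ} (hm : m < L) :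
    pairAmplitude w μ x L (L - 1 - m) = -pairAmplitude w μ x L m := by
  rw [pairAmplitude, pairAmplitude, pairRatio_reflect hm]
  push_cast
  ring

theorem modeDiscriminant_nonneg (hw : 0 ≤ w) (hμ : 0 ≤ μ) (hx : 0 ≤ x) (L m : ℕ) :
    0 ≤ modeDiscriminant w μ x L m := by
  unfold modeDiscriminant; positivity

theorem two_mul_sin_mul_pairRatio (hw : 0 ≤ w) (hμ : 0 < μ) (hx : 0 ≤ x) (hL : L ≠ 0) (m : ℕ) :
    2 * μ * Real.sin (momentum L m) * pairRatio w μ x L m =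
      -(modeDiagonal w μ x L m + √(modeDiscriminant w μ x L m)) := by
  rcases eq_or_ne (Real.sin (momentum L m)) 0 with hsin | hsin
  · have hdiag : modeDiagonal w μ x L m ≤ 0 := by
      rw [modeDiagonal, cos_momentum_eq_neg_one_of_sin_eq_zero hL hsin]
      linarith [mul_nonneg hw hx]
    rw [modeDiscriminant, hsin, zero_pow two_ne_zero, mul_zero (4 * _ * μ), add_zero,
      Real.sqrt_sq_eq_abs, abs_of_nonpos hdiag]
    ring
  · rw [pairRatio]
    field_simp

theorem pairRatio_riccati (hw : 0 ≤ w) (hμ : 0 < μ) (hx : 0 ≤ x) (hL : L ≠ 0) (m : ℕ) :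
    μ * Real.sin (momentum L m) * pairRatio w μ x L m ^ 2 +
      modeDiagonal w μ x L m * pairRatio w μ x L m =
      (μ + 2 * w * x) * Real.sin (momentum L m) := by
  rcases eq_or_ne (Real.sin (momentum L m)) 0 with hsin | hsin
  · simp [pairRatio, hsin]
  · have hroot := two_mul_sin_mul_pairRatio hw hμ hx hL m
    have hsq := Real.sq_sqrt (modeDiscriminant_nonneg hw hμ.le hx L m)
    rw [show √(modeDiscriminant w μ x L m) = -(2 * μ * Real.sin (momentum L m) *
      pairRatio w μ x L m + modeDiagonal w μ x L m) by linarith] at hsq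
    conv_rhs at hsq => rw [modeDiscriminant]
    refine mul_left_cancel₀ (by positivity : 4 * μ * Real.sin (momentum L m) ≠ 0) ?_
    linear_combination hsq

theorem pairAmplitude_riccati (hw : 0 ≤ w) (hμ : 0 < μ) (hx : 0 ≤ x) (hL : L ≠ 0) (m : ℕ) :
    modeDiagonal w μ x L m * pairAmplitude w μ x L m + (μ + 2 * w * x) / L * phase L m -
      μ * L * (phase L m)⁻¹ * pairAmplitude w μ x L m ^ 2 =
    ((μ + 2 * w * x + μ * pairRatio w μ x L m ^ 2) * Real.cos (momentum L m) / L : ℝ) := by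
  have hL' : (L : ℂ) ≠ 0 := Nat.cast_ne_zero.2 hL
  have hriccati := congrArg (fun r : ℝ => (r : ℂ)) (pairRatio_riccati hw hμ hx hL m)
  rw [phase_inv_eq_cos_sub_sin, phase_eq_cos_add_sin, pairAmplitude]
  push_cast at hriccati ⊢
  field_simp
  linear_combination (-Complex.I) * hriccati - μ * pairRatio w μ x L m ^ 2 *
    (Complex.cos (momentum L m) - Complex.sin (momentum L m) * Complex.I) * Complex.I_sq

theorem sum_pairAmplitude_energy (hw : 0 ≤ w) (hμ : 0 < μ) (hx : 0 ≤ x) (hL : 2 ≤ L) :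
    ∑ m ∈ Finset.range L, μ * L * (phase L m)⁻¹ * pairAmplitude w μ x L m =
      (topEigenvalue w μ x L + μ * L : ℝ) := by
  have hL0 : (L : ℂ) ≠ 0 := Nat.cast_ne_zero.2 (by omega)
  have hterm (m : ℕ) : μ * L * (phase L m)⁻¹ * pairAmplitude w μ x L m =
      ((modeDiagonal w μ x L m + √(modeDiscriminant w μ x L m)) / 2 : ℝ) +
        -Complex.I * (μ * Real.cos (momentum L m) * pairRatio w μ x L m : ℝ) := by
    rw [← neg_neg (modeDiagonal w μ x L m + √(modeDiscriminant w μ x L m)),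
      ← two_mul_sin_mul_pairRatio hw hμ hx (by omega) m, phase_inv_eq_cos_sub_sin, pairAmplitude]
    push_cast
    field_simp
    linear_combination
      (μ * pairRatio w μ x L m * Complex.sin (momentum L m)) * Complex.I_sq
  have hodd : ∑ m ∈ Finset.range L,
      -Complex.I * (μ * Real.cos (momentum L m) * pairRatio w μ x L m : ℝ) = 0 :=
    sum_range_eq_zero_of_reflect_neg fun m hm => by
      rw [cos_momentum_reflect hm, pairRatio_reflect hm]
      push_cast
      ring
  simp_rw [hterm]
  rw [Finset.sum_add_distrib, hodd, add_zero, ← Complex.ofReal_sum, ← Finset.sum_div,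
    Finset.sum_add_distrib, sum_modeDiagonal w μ x hL, topEigenvalue]
  push_cast
  ring

theorem momentumAnnihilator_topVector {m : ℕ} (hm : m < L) :
    momentumAnnihilator L m (topVector w μ x L) =
      pairAmplitude w μ x L m • momentumCreator L (L - 1 - m) (topVector w μ x L) :=
  (isCAR_momentum L).annihilate_fullPairState (fun m _ => momentumAnnihilator_vacuum m)
    (fun _ hm => pairAmplitude_reflect hm) hm

theorem parity_topVector (w μ x : ℝ) (L : ℕ) :
    parity L (topVector w μ x L) = topVector w μ x L :=
  map_pairState_eq_self parity_mul_momentumCreator parity_vacuum _ _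

theorem topVector_apply_empty (w μ x : ℝ) (L : ℕ) : topVector w μ x L (fun _ => false) = 1 := by
  have hpair (G : ℕ → ℂ) (n : ℕ) :
      pairState L (momentumCreator L) (vacuum L) G n (fun _ => false) = 1 := by
    induction n with
    | zero => simp [pairState, vacuum]
    | succ n ih => simp [pairState, ih, momentumCreator_apply_empty]
  exact hpair _ _

theorem tiltedGenerator_eq_quadraticHamiltonian (hL : 2 ≤ L) (w μ x : ℝ) {f : Config L → ℂ}
    (hf : parity L f = f) :
    tiltedGenerator ℂ w μ x L f =
      quadraticHamiltonian L (fun m => modeDiagonal w μ x L m)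
        (fun m => (μ + 2 * w * x) / L * phase L m) (fun m => μ * L * (phase L m)⁻¹)
        (momentumAnnihilator L) (momentumCreator L) f - (μ * L) • f := by
  have hnumber : quadraticHamiltonian L (fun m => modeDiagonal w μ x L m)
        (fun m => (μ + 2 * w * x) / L * phase L m) (fun m => μ * L * (phase L m)⁻¹)
        (momentumAnnihilator L) (momentumCreator L) =
      quadraticHamiltonian L (fun m => (μ + w * x) * (phase L m + (phase L m)⁻¹))
        (fun m => (μ + 2 * w * x) / L * phase L m) (fun m => μ * L * (phase L m)⁻¹)
        (momentumAnnihilator L) (momentumCreator L) -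
      (2 * w : ℂ) • ∑ m ∈ Finset.range L, momentumCreator L m * momentumAnnihilator L m := by
    rw [quadraticHamiltonian, quadraticHamiltonian, Finset.smul_sum, ← Finset.sum_sub_distrib]
    refine Finset.sum_congr rfl fun m _ => ?_
    rw [modeDiagonal_eq_phase]
    module
  ext η
  rw [hnumber, ← sum_bondOperator (μ + 2 * w * x : ℂ) (μ + w * x) μ]
  simp only [Pi.sub_apply, Pi.smul_apply, LinearMap.sub_apply, LinearMap.smul_apply]
  rw [← sum_flip_eq_sum_bondOperator hL w μ x hf,
    sum_momentumCreator_mul_momentumAnnihilator_apply, tiltedGenerator_apply,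
    Finset.sum_sub_distrib, ← Finset.sum_smul, Finset.sum_add_distrib, ← Finset.mul_sum,
    Finset.sum_add_distrib, sum_occ_succ]
  simp only [Complex.real_smul, Finset.sum_const, Finset.card_range, smul_eq_mul]
  push_cast
  ring

theorem tiltedGenerator_topVector (hw : 0 ≤ w) (hμ : 0 < μ) (hx : 0 ≤ x) (hL : 2 ≤ L) :
    tiltedGenerator ℂ w μ x L (topVector w μ x L) = topEigenvalue w μ x L • topVector w μ x L := by
  rw [tiltedGenerator_eq_quadraticHamiltonian hL w μ x (parity_topVector w μ x L),
    quadraticHamiltonian_apply_of_paired (isCAR_momentum L)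
      (fun m hm => momentumAnnihilator_topVector hm) (fun m hm => pairAmplitude_reflect hm)
      (fun m hm => ?_), sum_pairAmplitude_energy hw hμ hx hL]
  · ext η
    simp
    ring
  · rw [pairAmplitude_riccati hw hμ hx (by omega), pairAmplitude_riccati hw hμ hx (by omega),
      pairRatio_reflect hm, cos_momentum_reflect hm, neg_sq]

theorem continuous_topVector [NeZero L] (w μ : ℝ) : Continuous fun x => topVector w μ x L :=
  continuous_pairState (G := fun x => pairAmplitude w μ x L) _ _ (fun m => by
    unfold pairAmplitude pairRatio modeDiscriminant modeDiagonal
    fun_prop) _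

end Spectrum

section Positivity

theorem pos_of_nonneg_imp_pos {X ι : Type*} [TopologicalSpace X] [PreconnectedSpace X] [Finite ι]
    {f : X → ι → ℝ} (hf : Continuous f) (himp : ∀ x, (∀ i, 0 ≤ f x i) → ∀ i, 0 < f x i) {x₀ : X}
    (hx₀ : ∀ i, 0 < f x₀ i) (x : X) (i : ι) : 0 < f x i := by
  have hclosed : IsClosed {x | ∀ i, 0 ≤ f x i} := by
    simp only [Set.ofPred_forall]
    exact isClosed_iInter fun i => isClosed_le continuous_const ((continuous_apply i).comp hf)
  have hopen : IsOpen {x | ∀ i, 0 < f x i} := by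
    simp only [Set.ofPred_forall]
    exact isOpen_iInter_of_finite fun i => isOpen_lt continuous_const ((continuous_apply i).comp hf)
  have heq : {x | ∀ i, 0 ≤ f x i} = {x | ∀ i, 0 < f x i} :=
    Set.Subset.antisymm himp fun x hx i => (hx i).le
  have huniv := IsClopen.eq_univ ⟨heq ▸ hclosed, hopen⟩ ⟨x₀, hx₀⟩
  exact (huniv ▸ Set.mem_univ x : x ∈ {x | ∀ i, 0 < f x i}) i

variable {L : ℕ}

theorem isEven_empty (L : ℕ) : IsEven (fun _ => false : Config L) := by
  simp [IsEven]

theorem exists_isEven_forall_lt_eq_false {P : Config L → Prop}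
    (hL : 2 ≤ L) (hflip : ∀ η, IsEven η → P η → ∀ k < L, P (flip η (k : ZMod L))) {η : Config L}
    (hη : IsEven η) (hP : P η) (n : ℕ) (hn : n < L) :
    ∃ ζ : Config L, IsEven ζ ∧ P ζ ∧ ∀ i < n, ζ (i : ZMod L) = false := by
  induction n with
  | zero => exact ⟨η, hη, hP, fun i hi => absurd hi (Nat.not_lt_zero i)⟩
  | succ n ih =>
    obtain ⟨ζ, heven, hPζ, hempty⟩ := ih (by omega)
    rcases hn' : ζ (n : ZMod L) with _ | _
    · refine ⟨ζ, heven, hPζ, fun i hi => ?_⟩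
      rcases Nat.lt_succ_iff_lt_or_eq.1 hi with hi | rfl
      · exact hempty i hi
      · exact hn'
    · refine ⟨flip ζ (n : ZMod L), isEven_flip hL (by omega) heven,
        hflip ζ heven hPζ n (by omega), fun i hi => ?_⟩
      rw [flip_eq_of_lt hn]
      rcases Nat.lt_succ_iff_lt_or_eq.1 hi with hi | rfl
      · rw [flipSite_apply_of_ne (by omega) (by omega) (by omega),
          flipSite_apply_of_ne (by omega) (by omega) (by omega), hempty i hi]
      · rw [flipSite_apply_self, flipSite_apply_of_ne (by omega) (by omega) (by omega), hn']
        rfl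

theorem IsEven.eq_empty {n : ℕ} {η : Config (n + 1)} (hη : IsEven η)
    (hempty : ∀ i < n, η (i : ZMod (n + 1)) = false) : η = fun _ => false := by
  have hlast : η (n : ZMod (n + 1)) = false := by
    rw [IsEven, Finset.sum_range_succ, Finset.sum_eq_zero, zero_add] at hη
    · by_contra hne
      rw [Bool.not_eq_false] at hne
      exact absurd (hne ▸ hη) (by decide)
    · intro i hi
      rw [hempty i (Finset.mem_range.1 hi)]
      rfl
  funext j
  rw [← ZMod.natCast_zmod_val j]
  rcases Nat.lt_succ_iff_lt_or_eq.1 (ZMod.val_lt j) with hj | hj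
  · rw [hempty _ hj]
  · rw [hj, hlast]

theorem IsEven.empty_of_flip {P : Config L → Prop} {η : Config L} (hη : IsEven η) (hL : 2 ≤ L)
    (hflip : ∀ η, IsEven η → P η → ∀ k < L, P (flip η (k : ZMod L))) (hP : P η) :
    P fun _ => false := by
  obtain ⟨n, rfl⟩ : ∃ n, L = n + 1 := ⟨L - 1, by omega⟩
  obtain ⟨ζ, heven, hPζ, hempty⟩ :=
    exists_isEven_forall_lt_eq_false hL hflip hη hP n (by omega)
  exact heven.eq_empty hempty ▸ hPζ

theorem occ_nonneg (η : Config L) (k : ZMod L) : 0 ≤ occ η k := Nat.cast_nonneg _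

theorem occ_le_one (η : Config L) (k : ZMod L) : occ η k ≤ 1 := by
  unfold occ
  cases η k <;> simp

variable {w μ x : ℝ}

theorem rate_pos (hw : 0 ≤ w) (hμ : 0 < μ) (hx : 0 ≤ x) (η : Config L) (k : ZMod L) :
    0 < μ + w * x * (occ η k + occ η (k + 1)) :=
  add_pos_of_pos_of_nonneg hμ
    (mul_nonneg (mul_nonneg hw hx) (add_nonneg (occ_nonneg η k) (occ_nonneg η (k + 1))))

theorem apply_empty_eq_zero_of_eigenvector (hw : 0 ≤ w) (hμ : 0 < μ) (hx : 0 ≤ x) (hL : 2 ≤ L)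
    {f : Config L → ℝ} (hnonneg : ∀ η, IsEven η → 0 ≤ f η) {r : ℝ}
    (heigen : tiltedGenerator ℝ w μ x L f = r • f) {η : Config L} (hη : IsEven η)
    (hzero : f η = 0) : f (fun _ => false) = 0 := by
  refine hη.empty_of_flip (P := fun ζ => f ζ = 0) hL (fun ζ hζ hζ0 k hk => ?_) hzero
  have hsum := congrFun heigen ζ
  simp only [tiltedGenerator_apply, Pi.smul_apply, hζ0, sub_zero, smul_eq_mul,
    mul_zero] at hsum
  rw [Finset.sum_eq_zero_iff_of_nonneg fun k hk => mul_nonneg (rate_pos hw hμ hx ζ _).le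
    (hnonneg _ (isEven_flip hL (Finset.mem_range.1 hk) hζ))] at hsum
  exact (mul_eq_zero.1 (hsum k (Finset.mem_range.2 hk))).resolve_left (rate_pos hw hμ hx ζ _).ne'

theorem pos_of_eigenvector (hw : 0 ≤ w) (hμ : 0 < μ) (hx : 0 ≤ x) (hL : 2 ≤ L) {f : Config L → ℝ}
    (hnonneg : ∀ η, IsEven η → 0 ≤ f η) (hempty : f (fun _ => false) ≠ 0) {r : ℝ}
    (heigen : tiltedGenerator ℝ w μ x L f = r • f) {η : Config L} (hη : IsEven η) : 0 < f η :=
  (hnonneg η hη).lt_of_ne fun hzero =>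
    hempty (apply_empty_eq_zero_of_eigenvector hw hμ hx hL hnonneg heigen hη hzero.symm)

theorem tiltedGenerator_one_const (w μ : ℝ) (L : ℕ) (c : ℝ) :
    tiltedGenerator ℝ w μ 1 L (fun _ => c) = 0 := by
  ext η
  simp [tiltedGenerator_apply]

theorem pos_of_harmonic (hw : 0 ≤ w) (hμ : 0 < μ) (hL : 2 ≤ L)
    {f : Config L → ℝ} (hempty : 0 < f (fun _ => false)) (hf : tiltedGenerator ℝ w μ 1 L f = 0)
    {η : Config L} (hη : IsEven η) : 0 < f η := by
  have : NeZero L := ⟨by omega⟩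
  obtain ⟨ζ, hζ, hmin⟩ := Set.exists_min_image {η : Config L | IsEven η} f (Set.toFinite _)
    ⟨fun _ => false, isEven_empty L⟩
  have hharm : tiltedGenerator ℝ w μ 1 L (f - fun _ => f ζ) = (0 : ℝ) • (f - fun _ => f ζ) := by
    rw [map_sub, hf, tiltedGenerator_one_const, sub_zero, zero_smul]
  have hattained : f (fun _ => false) - f ζ = 0 :=
    apply_empty_eq_zero_of_eigenvector hw hμ zero_le_one hL (f := f - fun _ => f ζ)
      (fun θ hθ => sub_nonneg.2 (hmin θ hθ)) hharm hζ (sub_self _)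
  linarith [hmin η hη]

theorem topEigenvalue_one (hw : 0 ≤ w) (hμ : 0 ≤ μ) (hL : 2 ≤ L) : topEigenvalue w μ 1 L = 0 := by
  have hsqrt (m : ℕ) : √(modeDiscriminant w μ 1 L m) =
      2 * (μ + w) - 2 * w * Real.cos (momentum L m) := by
    rw [Real.sqrt_eq_iff_mul_self_eq (modeDiscriminant_nonneg hw hμ zero_le_one L m)
      (by nlinarith [Real.cos_le_one (momentum L m)]), modeDiscriminant, modeDiagonal]
    linear_combination (4 * (μ + 2 * w) * μ) * Real.sin_sq_add_cos_sq (momentum L m)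
  simp_rw [topEigenvalue, hsqrt]
  rw [Finset.sum_sub_distrib, ← Finset.mul_sum _ _ (2 * w), sum_cos_momentum hL, Finset.sum_const,
    Finset.card_range, nsmul_eq_mul]
  ring

/-- The real part of the dominant eigenvector of the tilted generator in the even sector. -/
noncomputable def realTopVector (w μ x : ℝ) (L : ℕ) : Config L → ℝ :=
  Complex.reLm ∘ topVector w μ x L

theorem realTopVector_apply_empty (w μ x : ℝ) (L : ℕ) :
    realTopVector w μ x L (fun _ => false) = 1 := by
  simp [realTopVector, topVector_apply_empty]

theorem tiltedGenerator_realTopVector (hw : 0 ≤ w) (hμ : 0 < μ) (hx : 0 ≤ x) (hL : 2 ≤ L) :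
    tiltedGenerator ℝ w μ x L (realTopVector w μ x L) =
      topEigenvalue w μ x L • realTopVector w μ x L := by
  rw [realTopVector, tiltedGenerator_comp, tiltedGenerator_topVector hw hμ hx hL]
  ext η
  simp

theorem continuous_realTopVector [NeZero L] (w μ : ℝ) :
    Continuous fun x => realTopVector w μ x L :=
  continuous_pi fun η =>
    Complex.continuous_re.comp ((continuous_apply η).comp (continuous_topVector w μ))

theorem realTopVector_pos (hw : 0 ≤ w) (hμ : 0 < μ) (hL : 2 ≤ L) (s : ℝ) {η : Config L}
    (hη : IsEven η) : 0 < realTopVector w μ (Real.exp s) L η := by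
  have : NeZero L := ⟨by omega⟩
  refine pos_of_nonneg_imp_pos (ι := {η : Config L // IsEven η})
    (f := fun s η => realTopVector w μ (Real.exp s) L η) (x₀ := 0) ?_ ?_ ?_ s ⟨η, hη⟩
  · exact continuous_pi fun η =>
      (continuous_apply η.1).comp ((continuous_realTopVector w μ).comp Real.continuous_exp)
  · intro s hnonneg η
    exact pos_of_eigenvector hw hμ (Real.exp_pos s).le hL (fun ζ hζ => hnonneg ⟨ζ, hζ⟩)
      (by rw [realTopVector_apply_empty]; exact one_ne_zero)
      (tiltedGenerator_realTopVector hw hμ (Real.exp_pos s).le hL) η.2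
  · intro η
    rw [Real.exp_zero]
    refine pos_of_harmonic hw hμ hL ?_ ?_ η.2
    · rw [realTopVector_apply_empty]
      exact one_pos
    · rw [tiltedGenerator_realTopVector hw hμ zero_le_one hL, topEigenvalue_one hw hμ.le hL,
        zero_smul]

end Positivity

section Exponential

theorem exists_pos_forall_mul_le {ι : Type*} {s : Set ι} (hs : s.Finite) {f : ι → ℝ}
    (hf : ∀ i ∈ s, 0 < f i) (g : ι → ℝ) : ∃ a > 0, ∀ i ∈ s, a * g i ≤ f i := by
  obtain ⟨C, hC⟩ := (hs.image fun i => g i / f i).bddAbove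
  refine ⟨(max C 1)⁻¹, by positivity, fun i hi => (inv_mul_le_iff₀ (by positivity)).2 ?_⟩
  rw [← div_le_iff₀ (hf i hi)]
  exact (hC (Set.mem_image_of_mem _ hi)).trans (le_max_left _ _)

theorem tendsto_log_div_of_exp_bounds {u : ℝ → ℝ} {a b r : ℝ} (ha : 0 < a)
    (hlower : ∀ᶠ t in atTop, a * Real.exp (r * t) ≤ u t)
    (hupper : ∀ᶠ t in atTop, u t ≤ b * Real.exp (r * t)) :
    Tendsto (fun t => Real.log (u t) / t) atTop (𝓝 r) := by
  obtain ⟨t₀, hlower₀, hupper₀⟩ := (hlower.and hupper).exists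
  have hb : 0 < b := ha.trans_le (le_of_mul_le_mul_right (hlower₀.trans hupper₀) (Real.exp_pos _))
  have hlog {C : ℝ} (hC : 0 < C) {t : ℝ} (ht : 0 < t) :
      Real.log (C * Real.exp (r * t)) / t = Real.log C / t + r := by
    rw [Real.log_mul hC.ne' (Real.exp_ne_zero _), Real.log_exp]
    field_simp
  have hlim (C : ℝ) : Tendsto (fun t : ℝ => C / t + r) atTop (𝓝 r) := by
    simpa using (tendsto_const_nhds (x := C)).div_atTop tendsto_id |>.add_const r
  refine tendsto_of_tendsto_of_tendsto_of_le_of_le' (hlim (Real.log a)) (hlim (Real.log b)) ?_ ?_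
  · filter_upwards [eventually_gt_atTop 0, hlower] with t ht hle
    rw [← hlog ha ht]
    gcongr
  · filter_upwards [eventually_gt_atTop 0, hlower, hupper] with t ht hle hle'
    have hpos : 0 < u t := hle.trans_lt' (by positivity)
    rw [← hlog hb ht]
    gcongr

variable {ι : Type*} [Fintype ι]

/-- The exponential of an endomorphism of a finite-dimensional space of functions, that is, the
time-one map of the semigroup it generates. -/
noncomputable def expEnd (T : Module.End ℝ (ι → ℝ)) : (ι → ℝ) →L[ℝ] (ι → ℝ) :=
  NormedSpace.exp (Module.End.toContinuousLinearMap (ι → ℝ) T)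

theorem hasSum_expEnd (T : Module.End ℝ (ι → ℝ)) (f : ι → ℝ) (i : ι) :
    HasSum (fun m : ℕ => (m.factorial : ℝ)⁻¹ * (T ^ m) f i) (expEnd T f i) := by
  have hexp := NormedSpace.exp_series_hasSum_exp' (𝕂 := ℝ)
    (Module.End.toContinuousLinearMap (ι → ℝ) T)
  convert (hexp.mapL (ContinuousLinearMap.apply ℝ (ι → ℝ) f)).mapL
    (ContinuousLinearMap.proj (R := ℝ) (φ := fun _ : ι => ℝ) i) using 2 with m
  · rw [← map_pow]
    rfl
  · rfl

theorem expEnd_apply_of_eigenvector {T : Module.End ℝ (ι → ℝ)} {f : ι → ℝ} {r : ℝ}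
    (hf : T f = r • f) : expEnd T f = Real.exp r • f := by
  have hpow (m : ℕ) : (T ^ m) f = r ^ m • f := by
    induction m with
    | zero => simp
    | succ m ih => rw [pow_succ, Module.End.mul_apply, hf, map_smul, ih, smul_smul, pow_succ']
  ext i
  refine (hasSum_expEnd T f i).unique ?_
  have hexp := (NormedSpace.exp_series_hasSum_exp' (𝕂 := ℝ) r).mul_right (f i)
  rw [← Real.exp_eq_exp_ℝ] at hexp
  simpa only [hpow, Pi.smul_apply, smul_eq_mul, mul_assoc] using hexp

theorem expEnd_add_smul_one (T : Module.End ℝ (ι → ℝ)) (c : ℝ) :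
    expEnd (T + c • 1) = Real.exp c • expEnd T := by
  let _ : NormedAlgebra ℚ ((ι → ℝ) →L[ℝ] (ι → ℝ)) := NormedAlgebra.restrictScalars ℚ ℝ _
  rw [expEnd, map_add, map_smul, map_one,
    NormedSpace.exp_add_of_commute ((Commute.one_right _).smul_right c),
    ← Algebra.algebraMap_eq_smul_one, ← NormedSpace.algebraMap_exp_comm,
    Algebra.algebraMap_eq_smul_one, mul_smul_comm, mul_one, ← Real.exp_eq_exp_ℝ, expEnd]

variable {T : Module.End ℝ (ι → ℝ)} {s : Set ι}

theorem expEnd_nonneg (hT : ∀ f : ι → ℝ, (∀ i ∈ s, 0 ≤ f i) → ∀ i ∈ s, 0 ≤ T f i) {f : ι → ℝ}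
    (hf : ∀ i ∈ s, 0 ≤ f i) {i : ι} (hi : i ∈ s) : 0 ≤ expEnd T f i := by
  have hpow (m : ℕ) : ∀ i ∈ s, 0 ≤ (T ^ m) f i := by
    induction m with
    | zero => simpa using hf
    | succ m ih =>
      rw [pow_succ']
      exact hT _ ih
  exact (hasSum_expEnd T f i).nonneg fun m => mul_nonneg (by positivity) (hpow m i hi)

theorem expEnd_smul_mono {c : ℝ}
    (hT : ∀ f : ι → ℝ, (∀ i ∈ s, 0 ≤ f i) → ∀ i ∈ s, 0 ≤ T f i + c * f i) {t : ℝ} (ht : 0 ≤ t)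
    {f g : ι → ℝ} (hfg : ∀ i ∈ s, f i ≤ g i) {i : ι} (hi : i ∈ s) :
    expEnd (t • T) f i ≤ expEnd (t • T) g i := by
  have hnonneg := expEnd_nonneg (T := t • T + (t * c) • 1) (f := g - f) (fun f hf i hi => by
      simpa [mul_add, mul_assoc] using mul_nonneg ht (hT f hf i hi))
    (fun i hi => sub_nonneg.2 (hfg i hi)) hi
  rw [expEnd_add_smul_one, smul_apply, Pi.smul_apply, map_sub, smul_eq_mul,
    mul_nonneg_iff_of_pos_left (Real.exp_pos _)] at hnonneg
  exact sub_nonneg.1 hnonneg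

theorem tendsto_log_expEnd_div {c : ℝ}
    (hT : ∀ f : ι → ℝ, (∀ i ∈ s, 0 ≤ f i) → ∀ i ∈ s, 0 ≤ T f i + c * f i) {v : ι → ℝ} {r : ℝ}
    (hv : T v = r • v) (hvpos : ∀ i ∈ s, 0 < v i) {f : ι → ℝ} (hf : ∀ i ∈ s, 0 < f i) {i : ι}
    (hi : i ∈ s) : Tendsto (fun t : ℝ => Real.log (expEnd (t • T) f i) / t) atTop (𝓝 r) := by
  obtain ⟨a, ha, hav⟩ := exists_pos_forall_mul_le s.toFinite hf v
  obtain ⟨b, hb, hbf⟩ := exists_pos_forall_mul_le s.toFinite hvpos f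
  have hflow (d t : ℝ) : expEnd (t • T) (d • v) i = d * v i * Real.exp (r * t) := by
    rw [map_smul, expEnd_apply_of_eigenvector (r := r * t)
      (by rw [LinearMap.smul_apply, hv, smul_smul, mul_comm]), Pi.smul_apply, Pi.smul_apply,
      smul_eq_mul, smul_eq_mul]
    ring
  refine tendsto_log_div_of_exp_bounds (mul_pos ha (hvpos i hi)) (b := b⁻¹ * v i) ?_ ?_
  · filter_upwards [eventually_ge_atTop 0] with t ht
    rw [← hflow]
    exact expEnd_smul_mono hT ht hav hi
  · filter_upwards [eventually_ge_atTop 0] with t ht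
    rw [← hflow]
    exact expEnd_smul_mono hT ht (fun j hj => (le_inv_mul_iff₀ hb).2 (hbf j hj)) hi

end Exponential

section JointProcess

variable {L : ℕ} {w μ : ℝ}

/-- The joint generator as an endomorphism. -/
noncomputable def jointGeneratorEnd (w μ : ℝ) (L : ℕ) : Module.End ℝ (Config L × ℕ → ℝ) where
  toFun := jointGenerator w μ L
  map_add' f g := by
    ext y
    refine Eq.trans (Finset.sum_congr rfl fun k _ => ?_) Finset.sum_add_distrib
    simp only [Pi.add_apply]
    ring
  map_smul' r f := by
    ext y
    refine Eq.trans (Finset.sum_congr rfl fun k _ => ?_) (Finset.mul_sum _ _ _).symm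
    simp only [Pi.smul_apply, smul_eq_mul, RingHom.id_apply]
    ring

theorem iterate_jointGenerator (m : ℕ) (f : Config L × ℕ → ℝ) :
    (jointGenerator w μ L)^[m] f = (jointGeneratorEnd w μ L ^ m) f :=
  (Module.End.pow_apply (jointGeneratorEnd w μ L) m f).symm

/-- The indicator function of the event that the activity equals `n`. -/
noncomputable def activityIndicator (L n : ℕ) : Config L × ℕ → ℝ :=
  fun y => if y.2 = n then 1 else 0

theorem iterate_jointGenerator_congr (m : ℕ) {f g : Config L × ℕ → ℝ} {a : ℕ}
    (hfg : ∀ ζ b, a ≤ b → b ≤ a + m → f (ζ, b) = g (ζ, b)) (η : Config L) :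
    (jointGenerator w μ L)^[m] f (η, a) = (jointGenerator w μ L)^[m] g (η, a) := by
  induction m generalizing a η with
  | zero => exact hfg η a le_rfl le_rfl
  | succ m ih =>
    have hsame (ζ) : _ = _ := ih (a := a) (fun ζ b hb hb' => hfg ζ b hb (by omega)) ζ
    have hraised (ζ) : _ = _ := ih (a := a + 1)
      (fun ζ b hb hb' => hfg ζ b (by omega) (by omega)) ζ
    simp only [Function.iterate_succ_apply', jointGenerator, hsame, hraised]

theorem iterate_jointGenerator_activityIndicator_of_lt {m n : ℕ} (hmn : m < n) (η : Config L) :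
    (jointGenerator w μ L)^[m] (activityIndicator L n) (η, 0) = 0 := by
  rw [iterate_jointGenerator_congr m (g := 0) fun ζ b _ hb => if_neg (by dsimp only; omega),
    iterate_jointGenerator, map_zero]
  rfl

theorem iterate_jointGenerator_exp (s : ℝ) (m : ℕ) :
    (jointGenerator w μ L)^[m] (fun y => Real.exp (s * y.2)) =
      fun y => Real.exp (s * y.2) * (tiltedGenerator ℝ w μ (Real.exp s) L ^ m) 1 y.1 := by
  induction m with
  | zero => ext; simp
  | succ m ih =>
    rw [Function.iterate_succ_apply', ih, pow_succ']
    ext y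
    rw [Module.End.mul_apply, tiltedGenerator_apply, Finset.mul_sum, jointGenerator]
    refine Finset.sum_congr rfl fun k _ => ?_
    have hexp : Real.exp (s * (y.2 + 1 : ℕ)) = Real.exp (s * y.2) * Real.exp s := by
      rw [← Real.exp_add]
      push_cast
      ring_nf
    rw [hexp, smul_eq_mul, smul_eq_mul]
    ring

theorem sum_iterate_jointGenerator_activityIndicator (s : ℝ) (m : ℕ) (η : Config L) :
    ∑ n ∈ Finset.range (m + 1),
      (jointGenerator w μ L)^[m] (activityIndicator L n) (η, 0) * Real.exp (s * n) =
    (tiltedGenerator ℝ w μ (Real.exp s) L ^ m) 1 η := by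
  have htilt := congrFun (iterate_jointGenerator_exp (L := L) (w := w) (μ := μ) s m) (η, 0)
  simp only [Nat.cast_zero, mul_zero, Real.exp_zero, one_mul] at htilt
  have htruncate := iterate_jointGenerator_congr (w := w) (μ := μ) m
    (f := fun y : Config L × ℕ => Real.exp (s * y.2))
    (g := ∑ n ∈ Finset.range (m + 1), Real.exp (s * n) • activityIndicator L n)
    (a := 0) (fun ζ b _ hb => by
      simp only [activityIndicator, Finset.sum_apply, Pi.smul_apply, smul_eq_mul, mul_ite, mul_one,
        mul_zero]
      rw [Finset.sum_ite_eq, if_pos (Finset.mem_range.2 (by omega))]) η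
  rw [← htilt, htruncate, iterate_jointGenerator, map_sum, Finset.sum_apply]
  refine Finset.sum_congr rfl fun n _ => ?_
  rw [map_smul, Pi.smul_apply, smul_eq_mul, iterate_jointGenerator, mul_comm]

theorem mul_occ_add_occ_nonneg (hw : 0 ≤ w) (η : Config L) (k : ZMod L) :
    0 ≤ w * (occ η k + occ η (k + 1)) :=
  mul_nonneg hw (add_nonneg (occ_nonneg η k) (occ_nonneg η (k + 1)))

theorem mul_occ_add_occ_le (hw : 0 ≤ w) (η : Config L) (k : ZMod L) :
    w * (occ η k + occ η (k + 1)) ≤ 2 * w := by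
  nlinarith [occ_le_one η k, occ_le_one η (k + 1)]

theorem abs_jointGenerator_le (hw : 0 ≤ w) (hμ : 0 ≤ μ) {f : Config L × ℕ → ℝ} {B : ℝ}
    (hf : ∀ y, |f y| ≤ B) (y : Config L × ℕ) :
    |jointGenerator w μ L f y| ≤ L * (2 * μ + 4 * w) * B := by
  have hbond (k : ZMod L) : |μ * f (flip y.1 k, y.2)
      + w * (occ y.1 k + occ y.1 (k + 1)) * f (flip y.1 k, y.2 + 1)
      - (μ + w * (occ y.1 k + occ y.1 (k + 1))) * f y| ≤ (2 * μ + 4 * w) * B := by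
    have : 0 ≤ B := (abs_nonneg _).trans (hf y)
    have hrate := mul_occ_add_occ_nonneg hw y.1 k
    have hrate' := mul_occ_add_occ_le hw y.1 k
    generalize w * (occ y.1 k + occ y.1 (k + 1)) = o at hrate hrate'
    calc _ ≤ μ * |f (flip y.1 k, y.2)| + o * |f (flip y.1 k, y.2 + 1)| + (μ + o) * |f y| := by
          refine (abs_sub _ _).trans ((add_le_add (abs_add_le _ _) le_rfl).trans_eq ?_)
          rw [abs_mul, abs_mul, abs_mul, abs_of_nonneg hμ, abs_of_nonneg hrate,
            abs_of_nonneg (add_nonneg hμ hrate)]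
      _ ≤ μ * B + (2 * w) * B + (μ + 2 * w) * B := by gcongr <;> apply hf
      _ = (2 * μ + 4 * w) * B := by ring
  refine (Finset.abs_sum_le_sum_abs _ _).trans
    ((Finset.sum_le_sum fun (k : ℕ) _ => hbond k).trans_eq ?_)
  rw [Finset.sum_const, Finset.card_range, nsmul_eq_mul, mul_assoc]

theorem abs_iterate_jointGenerator_le (hw : 0 ≤ w) (hμ : 0 ≤ μ) {f : Config L × ℕ → ℝ}
    (hf : ∀ y, |f y| ≤ 1) (m : ℕ) (y : Config L × ℕ) :
    |(jointGenerator w μ L)^[m] f y| ≤ (L * (2 * μ + 4 * w)) ^ m := by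
  induction m generalizing y with
  | zero => simpa using hf y
  | succ m ih =>
    rw [Function.iterate_succ_apply', pow_succ']
    exact abs_jointGenerator_le hw hμ ih y

theorem summable_ite_le_pow_div_factorial {y : ℝ} (hy : 0 ≤ y) :
    Summable fun p : ℕ × ℕ => if p.2 ≤ p.1 then y ^ p.1 / (p.1.factorial : ℝ) else 0 := by
  have hrow (m : ℕ) : HasSum (fun n => if n ≤ m then y ^ m / (m.factorial : ℝ) else 0)
      ((m + 1) * (y ^ m / (m.factorial : ℝ))) := by
    have hfinite : HasSum (fun n => if n ≤ m then y ^ m / (m.factorial : ℝ) else 0)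
        (∑ n ∈ Finset.range (m + 1), if n ≤ m then y ^ m / (m.factorial : ℝ) else 0) :=
      hasSum_sum_of_ne_finset_zero fun n hn => if_neg (by simpa using hn)
    rw [Finset.sum_congr rfl fun n hn => if_pos (by simpa [Nat.lt_succ_iff] using hn)] at hfinite
    simpa using hfinite
  rw [summable_prod_of_nonneg fun p => by dsimp only [Pi.zero_apply]; split_ifs <;> positivity]
  refine ⟨fun m => (hrow m).summable, ?_⟩
  simp only [fun m => (hrow m).tsum_eq]
  refine Summable.of_nonneg_of_le (fun m => by positivity) (fun m => ?_)
    (Real.summable_pow_div_factorial (2 * y))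
  rw [mul_pow, mul_div_assoc]
  gcongr
  exact_mod_cast Nat.lt_two_pow_self (n := m)

/-- The general term of the moment generating function of the activity, expanded in the order `m`
of the exponential series and in the activity `n`. -/
noncomputable def activityTerm (w μ : ℝ) (L : ℕ) (η : Config L) (s t : ℝ) (m n : ℕ) : ℝ :=
  t ^ m / (m.factorial : ℝ) * (jointGenerator w μ L)^[m] (activityIndicator L n) (η, 0) *
    Real.exp (s * n)

theorem activityMGF_eq_tsum_activityTerm (w μ : ℝ) (η : Config L) (s t : ℝ) :
    activityMGF w μ L η s t = ∑' n, ∑' m, activityTerm w μ L η s t m n := by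
  simp only [activityMGF, activityProb, semigroup, activityTerm, tsum_mul_right]
  rfl

theorem activityTerm_of_lt {m n : ℕ} (hmn : m < n) (η : Config L) (s t : ℝ) :
    activityTerm w μ L η s t m n = 0 := by
  rw [activityTerm, iterate_jointGenerator_activityIndicator_of_lt hmn, mul_zero, zero_mul]

theorem abs_activityTerm_le (hw : 0 ≤ w) (hμ : 0 ≤ μ) (η : Config L) (s t : ℝ) {m n : ℕ}
    (hnm : n ≤ m) : |activityTerm w μ L η s t m n| ≤
      (|t| * (L * (2 * μ + 4 * w)) * Real.exp |s|) ^ m / (m.factorial : ℝ) := by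
  have hiterate := abs_iterate_jointGenerator_le hw hμ (f := activityIndicator L n)
    (fun y => by unfold activityIndicator; split_ifs <;> simp) m (η, 0)
  have hexp : Real.exp (s * n) ≤ Real.exp |s| ^ m := by
    rw [← Real.exp_nat_mul, Real.exp_le_exp]
    calc s * n ≤ |s| * n := by gcongr; exact le_abs_self s
      _ ≤ |s| * m := by gcongr
      _ = m * |s| := mul_comm _ _
  rw [activityTerm, abs_mul, abs_mul, Real.abs_exp, abs_div, abs_pow, Nat.abs_cast]
  calc _ ≤ |t| ^ m / (m.factorial : ℝ) * (L * (2 * μ + 4 * w)) ^ m * Real.exp |s| ^ m := by gcongr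
    _ = _ := by rw [mul_pow _ (Real.exp |s|), mul_pow |t|]; ring

theorem summable_activityTerm (hw : 0 ≤ w) (hμ : 0 ≤ μ) (η : Config L) (s t : ℝ) :
    Summable (Function.uncurry (activityTerm w μ L η s t)) := by
  refine Summable.of_norm_bounded (summable_ite_le_pow_div_factorial
    (y := |t| * (L * (2 * μ + 4 * w)) * Real.exp |s|) (by positivity)) ?_
  rintro ⟨m, n⟩
  rw [Function.uncurry_apply_pair]
  split_ifs with hnm
  · exact abs_activityTerm_le hw hμ η s t hnm
  · rw [activityTerm_of_lt (not_le.1 hnm), norm_zero]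

theorem activityMGF_eq_expEnd [NeZero L] (hw : 0 ≤ w) (hμ : 0 ≤ μ) (η : Config L) (s t : ℝ) :
    activityMGF w μ L η s t = expEnd (t • tiltedGenerator ℝ w μ (Real.exp s) L) 1 η := by
  rw [activityMGF_eq_tsum_activityTerm, (summable_activityTerm hw hμ η s t).tsum_comm,
    ← (hasSum_expEnd _ _ _).tsum_eq]
  refine tsum_congr fun m => ?_
  rw [tsum_eq_sum (s := Finset.range (m + 1))
    fun n hn => activityTerm_of_lt (by simpa using hn) η s t, smul_pow, LinearMap.smul_apply,
    Pi.smul_apply, ← sum_iterate_jointGenerator_activityIndicator, Finset.smul_sum, Finset.mul_sum]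
  refine Finset.sum_congr rfl fun n _ => ?_
  rw [smul_eq_mul, activityTerm]
  ring

theorem tiltedGenerator_add_mul_nonneg (hw : 0 ≤ w) (hμ : 0 < μ) {x : ℝ} (hx : 0 ≤ x) (hL : 2 ≤ L)
    {f : Config L → ℝ} (hf : ∀ η, IsEven η → 0 ≤ f η) {η : Config L} (hη : IsEven η) :
    0 ≤ tiltedGenerator ℝ w μ x L f η + L * (μ + 2 * w) * f η := by
  have hdiagonal : L * (μ + 2 * w) * f η = ∑ k ∈ Finset.range L, (μ + 2 * w) * f η := by
    rw [Finset.sum_const, Finset.card_range, nsmul_eq_mul, mul_assoc]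
  rw [tiltedGenerator_apply, hdiagonal, ← Finset.sum_add_distrib]
  refine Finset.sum_nonneg fun k hk => ?_
  rw [smul_eq_mul, smul_eq_mul, sub_add, ← sub_mul]
  have hflip := mul_nonneg (rate_pos hw hμ hx η k).le
    (hf _ (isEven_flip hL (Finset.mem_range.1 hk) hη))
  have hstay := mul_nonneg (sub_nonneg.2 (mul_occ_add_occ_le hw η k)) (hf η hη)
  linarith

theorem tendsto_scaledCGF (hw : 0 ≤ w) (hμ : 0 < μ) (hL : 2 ≤ L) {η : Config L}
    (hη : IsEven η) (s : ℝ) :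
    Tendsto (fun t : ℝ => scaledCGF w μ L η s t) atTop
      (𝓝 (topEigenvalue w μ (Real.exp s) L / L)) := by
  have : NeZero L := ⟨by omega⟩
  have hx := (Real.exp_pos s).le
  have hgrowth := tendsto_log_expEnd_div (s := {η : Config L | IsEven η})
    (fun f hf ζ hζ => tiltedGenerator_add_mul_nonneg hw hμ hx hL hf hζ)
    (tiltedGenerator_realTopVector hw hμ hx hL) (fun ζ hζ => realTopVector_pos hw hμ hL s hζ)
    (f := 1) (fun _ _ => one_pos) hη
  refine (hgrowth.div_const (L : ℝ)).congr fun t => ?_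
  rw [scaledCGF, activityMGF_eq_expEnd hw hμ.le, div_div, mul_comm t]

theorem limitingCGF_eq (hw : 0 ≤ w) (hμ : 0 < μ) (hL : 2 ≤ L) (s : ℝ) :
    limitingCGF w μ L s = topEigenvalue w μ (Real.exp s) L / L :=
  (tendsto_scaledCGF hw hμ hL (isEven_empty L) s).limUnder_eq

end JointProcess

section OddHarmonic

/-- The sum of the reciprocals of the first `L` odd numbers. -/
noncomputable def oddHarmonic (L : ℕ) : ℝ := ∑ m ∈ Finset.range L, 1 / (2 * (m : ℝ) + 1)

theorem oddHarmonic_eq (L : ℕ) :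
    oddHarmonic L = (harmonic (2 * L) : ℝ) - (harmonic L : ℝ) / 2 := by
  induction L with
  | zero => simp [oddHarmonic]
  | succ n ih =>
    rw [oddHarmonic] at ih ⊢
    rw [Finset.sum_range_succ, ih, show 2 * (n + 1) = 2 * n + 1 + 1 by ring, harmonic_succ,
      harmonic_succ, harmonic_succ]
    push_cast
    field_simp
    ring

theorem tendsto_log_natCast : Tendsto (fun L : ℕ => Real.log (L : ℝ)) atTop atTop :=
  Real.tendsto_log_atTop.comp tendsto_natCast_atTop_atTop

theorem eventually_log_natCast_pos : ∀ᶠ L : ℕ in atTop, 0 < Real.log (L : ℝ) :=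
  tendsto_log_natCast.eventually_gt_atTop 0

theorem tendsto_oddHarmonic_div_log :
    Tendsto (fun L : ℕ => oddHarmonic L / Real.log L) atTop (𝓝 (1 / 2)) := by
  have hharmonic := Real.tendsto_harmonic_sub_log
  have hdouble : Tendsto (fun L : ℕ => (harmonic (2 * L) : ℝ) - Real.log ((2 * L : ℕ) : ℝ)) atTop
      (𝓝 Real.eulerMascheroniConstant) :=
    hharmonic.comp (tendsto_id.const_mul_atTop' two_pos)
  have hlim := (((hdouble.sub (hharmonic.div_const 2)).add_const (Real.log 2)).div_atTop
    tendsto_log_natCast).add_const (1 / 2)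
  rw [zero_add] at hlim
  refine hlim.congr' ?_
  filter_upwards [eventually_ne_atTop 0, eventually_log_natCast_pos] with L hL hlog
  have hlog := hlog.ne'
  rw [oddHarmonic_eq]
  push_cast
  rw [Real.log_mul two_ne_zero (Nat.cast_ne_zero.2 hL)]
  field_simp
  ring

end OddHarmonic

section SingularSum

theorem inv_sin_sub_inv_le {y : ℝ} (hpos : 0 < y) (hle : y ≤ Real.pi / 2) :
    1 / Real.sin y - 1 / y ≤ 1 := by
  have hhalf : y / 2 ≤ Real.sin y := by
    refine le_trans ?_ (Real.mul_le_sin hpos.le hle)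
    rw [div_mul_eq_mul_div, div_le_div_iff₀ two_pos Real.pi_pos]
    nlinarith [Real.pi_le_four]
  have hsin : 0 < Real.sin y := (half_pos hpos).trans_le hhalf
  have htwo : y ≤ 2 := by linarith [Real.pi_le_four]
  rw [div_sub_div _ _ hsin.ne' hpos.ne', div_le_one (by positivity)]
  nlinarith [Real.sin_gt_sub_cube hpos, mul_le_mul_of_nonneg_right hhalf hpos.le,
    mul_le_mul_of_nonneg_right htwo (sq_nonneg y)]

theorem abs_inv_sin_sub_le_of_le_half_pi {y : ℝ} (hpos : 0 < y) (hle : y ≤ Real.pi / 2) :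
    |1 / Real.sin y - 1 / y - 1 / (Real.pi - y)| ≤ 2 := by
  have hsin : 0 < Real.sin y := Real.sin_pos_of_pos_of_lt_pi hpos (by linarith [Real.pi_pos])
  have hupper := inv_sin_sub_inv_le hpos hle
  have hlower : 1 / y ≤ 1 / Real.sin y := one_div_le_one_div_of_le hsin (Real.sin_le hpos.le)
  have hreflect : 1 / (Real.pi - y) ≤ 1 := by
    rw [div_le_one] <;> linarith [Real.pi_gt_three]
  have hreflect' : 0 ≤ 1 / (Real.pi - y) := one_div_nonneg.2 (by linarith [Real.pi_pos])
  rw [abs_le]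
  constructor <;> linarith

theorem abs_inv_sin_sub_le {y : ℝ} (hpos : 0 < y) (hlt : y < Real.pi) :
    |1 / Real.sin y - 1 / y - 1 / (Real.pi - y)| ≤ 2 := by
  rcases le_total y (Real.pi / 2) with hy | hy
  · exact abs_inv_sin_sub_le_of_le_half_pi hpos hy
  · have hreflect := abs_inv_sin_sub_le_of_le_half_pi (y := Real.pi - y) (by linarith) (by linarith)
    rw [Real.sin_pi_sub, sub_sub_cancel] at hreflect
    rwa [sub_right_comm]

variable {L : ℕ}

theorem half_momentum_pos (hL : L ≠ 0) (m : ℕ) : 0 < momentum L m / 2 := by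
  have := Nat.pos_of_ne_zero hL
  unfold momentum
  positivity

theorem half_momentum_lt_pi {m : ℕ} (hm : m < L) : momentum L m / 2 < Real.pi := by
  have hreflect := half_momentum_pos (by omega : L ≠ 0) (L - 1 - m)
  rw [momentum_reflect hm] at hreflect
  linarith

theorem sin_half_momentum_pos {m : ℕ} (hm : m < L) : 0 < Real.sin (momentum L m / 2) :=
  Real.sin_pos_of_pos_of_lt_pi (half_momentum_pos (by omega) m) (half_momentum_lt_pi hm)

theorem sum_inv_half_momentum (L : ℕ) :
    ∑ m ∈ Finset.range L, 1 / (momentum L m / 2) = 2 * L / Real.pi * oddHarmonic L := by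
  rw [oddHarmonic, Finset.mul_sum]
  refine Finset.sum_congr rfl fun m hm => ?_
  have hL : (L : ℝ) ≠ 0 := Nat.cast_ne_zero.2 (Nat.ne_zero_of_lt (Finset.mem_range.1 hm))
  rw [momentum]
  field_simp

theorem sum_inv_pi_sub_half_momentum (L : ℕ) :
    ∑ m ∈ Finset.range L, 1 / (Real.pi - momentum L m / 2) =
      2 * L / Real.pi * oddHarmonic L := by
  rw [← sum_inv_half_momentum, ← Finset.sum_range_reflect (fun m => 1 / (momentum L m / 2))]
  refine Finset.sum_congr rfl fun m hm => ?_
  rw [momentum_reflect (Finset.mem_range.1 hm)]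
  congr 1
  ring

theorem abs_sum_inv_sin_sub_le (L : ℕ) :
    |(∑ m ∈ Finset.range L, 1 / Real.sin (momentum L m / 2)) -
      4 * L / Real.pi * oddHarmonic L| ≤ 2 * L := by
  have hpoles : (∑ m ∈ Finset.range L, 1 / Real.sin (momentum L m / 2)) -
      4 * L / Real.pi * oddHarmonic L =
      ∑ m ∈ Finset.range L, (1 / Real.sin (momentum L m / 2) - 1 / (momentum L m / 2) -
        1 / (Real.pi - momentum L m / 2)) := by
    rw [Finset.sum_sub_distrib, Finset.sum_sub_distrib, sum_inv_half_momentum,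
      sum_inv_pi_sub_half_momentum]
    ring
  rw [hpoles]
  refine (Finset.abs_sum_le_sum_abs _ _).trans ((Finset.sum_le_sum fun m hm =>
    abs_inv_sin_sub_le (half_momentum_pos (Nat.ne_zero_of_lt (Finset.mem_range.1 hm)) m)
      (half_momentum_lt_pi (Finset.mem_range.1 hm))).trans_eq ?_)
  rw [Finset.sum_const, Finset.card_range, nsmul_eq_mul, mul_comm]

theorem abs_sum_div_sub_le {ι : Type*} (s : Finset ι) {σ : ι → ℝ} (hpos : ∀ i ∈ s, 0 < σ i)
    (hle : ∀ i ∈ s, σ i ≤ 1) {Ψ : ℝ → ℝ} {K : NNReal} (hΨ : LipschitzOnWith K Ψ (Set.Icc 0 1)) :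
    |(∑ i ∈ s, Ψ (σ i) / σ i) - Ψ 0 * ∑ i ∈ s, 1 / σ i| ≤ s.card * K := by
  have hterm (i) (hi : i ∈ s) : |Ψ (σ i) / σ i - Ψ 0 * (1 / σ i)| ≤ K := by
    have hlip := hΨ.dist_le_mul (σ i) ⟨(hpos i hi).le, hle i hi⟩ 0 ⟨le_rfl, zero_le_one⟩
    rw [Real.dist_eq, Real.dist_eq, sub_zero, abs_of_pos (hpos i hi)] at hlip
    rwa [mul_one_div, ← sub_div, abs_div, abs_of_pos (hpos i hi), div_le_iff₀ (hpos i hi)]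
  rw [Finset.mul_sum, ← Finset.sum_sub_distrib]
  refine (Finset.abs_sum_le_sum_abs _ _).trans ((Finset.sum_le_sum hterm).trans_eq ?_)
  rw [Finset.sum_const, nsmul_eq_mul]

theorem exists_abs_sum_div_sin_sub_le {Ψ : ℝ → ℝ} (hΨ : ContDiff ℝ 1 Ψ) : ∃ K : ℝ, ∀ L : ℕ,
    |(∑ m ∈ Finset.range L, Ψ (Real.sin (momentum L m / 2)) / Real.sin (momentum L m / 2)) -
      Ψ 0 * (4 * L / Real.pi * oddHarmonic L)| ≤ L * K := by
  obtain ⟨K, hK⟩ := hΨ.contDiffOn.exists_lipschitzOnWith (by decide) (convex_Icc (0 : ℝ) 1)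
    isCompact_Icc
  refine ⟨K + |Ψ 0| * 2, fun L => ?_⟩
  have hnumerator := abs_sum_div_sub_le (Finset.range L) (σ := fun m => Real.sin (momentum L m / 2))
    (fun m hm => sin_half_momentum_pos (Finset.mem_range.1 hm)) (fun m _ => Real.sin_le_one _) hK
  have hsingular := mul_le_mul_of_nonneg_left (abs_sum_inv_sin_sub_le L) (abs_nonneg (Ψ 0))
  rw [← abs_mul, mul_sub] at hsingular
  rw [Finset.card_range] at hnumerator
  refine (abs_sub_le _ _ _).trans ((add_le_add hnumerator hsingular).trans_eq ?_)
  ring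

theorem tendsto_sum_div_sin_div_log {Ψ : ℝ → ℝ} (hΨ : ContDiff ℝ 1 Ψ) :
    Tendsto (fun L : ℕ => (∑ m ∈ Finset.range L,
      Ψ (Real.sin (momentum L m / 2)) / Real.sin (momentum L m / 2)) / (2 * L) / Real.log L) atTop
      (𝓝 (Ψ 0 / Real.pi)) := by
  obtain ⟨K, hK⟩ := exists_abs_sum_div_sin_sub_le hΨ
  set S := fun L : ℕ => ∑ m ∈ Finset.range L,
    Ψ (Real.sin (momentum L m / 2)) / Real.sin (momentum L m / 2)
  have hbounded : ∀ᶠ L : ℕ in atTop,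
      |S L / (2 * L) - 2 * Ψ 0 / Real.pi * oddHarmonic L| ≤ K / 2 := by
    filter_upwards [eventually_gt_atTop 0] with L hL
    have : (0 : ℝ) < L := Nat.cast_pos.2 hL
    rw [show S L / (2 * L) - 2 * Ψ 0 / Real.pi * oddHarmonic L =
      (S L - Ψ 0 * (4 * L / Real.pi * oddHarmonic L)) / (2 * L) by field_simp; ring, abs_div,
      abs_of_pos (by positivity : (0 : ℝ) < 2 * L), div_le_iff₀ (by positivity)]
    exact (hK L).trans_eq (by ring)
  have herror := tendsto_bdd_div_atTop_nhds_zero (hbounded.mono fun L hL => (abs_le.1 hL).1)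
    (hbounded.mono fun L hL => (abs_le.1 hL).2) tendsto_log_natCast
  have hlim := herror.add (tendsto_oddHarmonic_div_log.const_mul (2 * Ψ 0 / Real.pi))
  rw [zero_add, show 2 * Ψ 0 / Real.pi * (1 / 2) = Ψ 0 / Real.pi by ring] at hlim
  exact hlim.congr fun L => by ring

end SingularSum

section Cumulants

variable {ν : ℝ} {L : ℕ}

theorem modeDiscriminant_pos {w μ x : ℝ} (hw : 0 < w) (hμ : 0 < μ) (hx : 0 < x) (hL : L ≠ 0)
    (m : ℕ) : 0 < modeDiscriminant w μ x L m := by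
  unfold modeDiscriminant
  rcases eq_or_ne (Real.sin (momentum L m)) 0 with hsin | hsin
  · have hdiagonal : modeDiagonal w μ x L m ≠ 0 := by
      rw [modeDiagonal, cos_momentum_eq_neg_one_of_sin_eq_zero hL hsin]
      nlinarith [mul_pos hw hx]
    positivity
  · positivity

theorem hasDerivAt_deriv_sqrt {g g₁ g₂ : ℝ → ℝ} {s : ℝ} (h₀ : HasDerivAt g (g₁ s) s)
    (h₁ : HasDerivAt g₁ (g₂ s) s) (hg : 0 < g s) :
    HasDerivAt (fun s => g₁ s / (2 * √(g s)))
      (g₂ s / (2 * √(g s)) - g₁ s ^ 2 / (4 * (g s * √(g s)))) s := by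
  have hsqrt := (Real.sqrt_pos.2 hg).ne'
  refine (h₁.div ((h₀.sqrt hg.ne').const_mul 2) (by positivity)).congr_deriv ?_
  field_simp
  rw [Real.sq_sqrt hg.le]
  ring

theorem hasDerivAt_deriv_deriv_sqrt {g g₁ g₂ g₃ : ℝ → ℝ} {s : ℝ} (h₀ : HasDerivAt g (g₁ s) s)
    (h₁ : HasDerivAt g₁ (g₂ s) s) (h₂ : HasDerivAt g₂ (g₃ s) s) (hg : 0 < g s) :
    HasDerivAt (fun s => g₂ s / (2 * √(g s)) - g₁ s ^ 2 / (4 * (g s * √(g s))))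
      (g₃ s / (2 * √(g s)) - 3 * g₁ s * g₂ s / (4 * (g s * √(g s))) +
        3 * g₁ s ^ 3 / (8 * (g s ^ 2 * √(g s)))) s := by
  have hsqrt := (Real.sqrt_pos.2 hg).ne'
  have hderiv := h₀.sqrt hg.ne'
  refine ((h₂.div (hderiv.const_mul 2) (by positivity)).sub
    ((h₁.fun_pow 2).div ((h₀.fun_mul hderiv).const_mul 4) (by positivity))).congr_deriv ?_
  field_simp
  rw [Real.sq_sqrt hg.le]
  push_cast
  ring

theorem iteratedDeriv_two_sqrt {g g₁ g₂ : ℝ → ℝ} (h₀ : ∀ s, HasDerivAt g (g₁ s) s)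
    (h₁ : ∀ s, HasDerivAt g₁ (g₂ s) s) (hg : ∀ s, 0 < g s) :
    iteratedDeriv 2 (fun s => √(g s)) =
      fun s => g₂ s / (2 * √(g s)) - g₁ s ^ 2 / (4 * (g s * √(g s))) := by
  rw [iteratedDeriv_succ, iteratedDeriv_one, funext fun s => ((h₀ s).sqrt (hg s).ne').deriv]
  exact funext fun s => (hasDerivAt_deriv_sqrt (h₀ s) (h₁ s) (hg s)).deriv

theorem iteratedDeriv_three_sqrt {g g₁ g₂ g₃ : ℝ → ℝ} (h₀ : ∀ s, HasDerivAt g (g₁ s) s)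
    (h₁ : ∀ s, HasDerivAt g₁ (g₂ s) s) (h₂ : ∀ s, HasDerivAt g₂ (g₃ s) s) (hg : ∀ s, 0 < g s) :
    iteratedDeriv 3 (fun s => √(g s)) =
      fun s => g₃ s / (2 * √(g s)) - 3 * g₁ s * g₂ s / (4 * (g s * √(g s))) +
        3 * g₁ s ^ 3 / (8 * (g s ^ 2 * √(g s))) := by
  rw [iteratedDeriv_succ, iteratedDeriv_two_sqrt h₀ h₁ hg]
  exact funext fun s => (hasDerivAt_deriv_deriv_sqrt (h₀ s) (h₁ s) (h₂ s) (hg s)).deriv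

/-- The `k`-th derivative of `a + b eˢ + c e²ˢ` with respect to `s`; the factor `0 ^ k` removes the
constant term when `k` is positive. -/
noncomputable def expQuadratic (a b c : ℝ) (k : ℕ) (s : ℝ) : ℝ :=
  a * 0 ^ k + b * Real.exp s + c * 2 ^ k * Real.exp (2 * s)

theorem hasDerivAt_expQuadratic (a b c : ℝ) (k : ℕ) (s : ℝ) :
    HasDerivAt (expQuadratic a b c k) (expQuadratic a b c (k + 1) s) s := by
  have hlinear := (Real.hasDerivAt_exp s).const_mul b
  have hquadratic := (((hasDerivAt_id s).const_mul 2).exp).const_mul (c * 2 ^ k)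
  refine ((hlinear.const_add (a * 0 ^ k)).add hquadratic).congr_deriv ?_
  simp only [expQuadratic, id, mul_one]
  ring

/-- The `k`-th derivative, with respect to the Legendre parameter, of the discriminant of a mode
for `w = 1/2` and `μ = (1 - ν) / 2`. -/
noncomputable def logDiscriminant (ν : ℝ) (L m k : ℕ) : ℝ → ℝ :=
  expQuadratic ((1 - ν) ^ 2 + 1 - 2 * (1 - ν) * Real.cos (momentum L m))
    (2 * (1 - ν) - 2 * Real.cos (momentum L m)) (Real.cos (momentum L m) ^ 2) k

theorem modeDiscriminant_exp (ν : ℝ) (L m : ℕ) (s : ℝ) :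
    modeDiscriminant (1 / 2) ((1 - ν) / 2) (Real.exp s) L m = logDiscriminant ν L m 0 s := by
  rw [modeDiscriminant, modeDiagonal, logDiscriminant, expQuadratic, two_mul s, Real.exp_add]
  linear_combination ((1 - ν) * (1 - ν + 2 * Real.exp s)) *
    Real.sin_sq_add_cos_sq (momentum L m)

theorem hasDerivAt_logDiscriminant (ν : ℝ) (L m k : ℕ) (s : ℝ) :
    HasDerivAt (logDiscriminant ν L m k) (logDiscriminant ν L m (k + 1) s) s :=
  hasDerivAt_expQuadratic _ _ _ k s

theorem logDiscriminant_pos (hν : ν < 1) (hL : L ≠ 0) (m : ℕ) (s : ℝ) :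
    0 < logDiscriminant ν L m 0 s := by
  rw [← modeDiscriminant_exp]
  exact modeDiscriminant_pos (by norm_num) (by linarith) (Real.exp_pos s) hL m

theorem contDiff_sqrt_logDiscriminant (hν : ν < 1) (hL : L ≠ 0) (m : ℕ) {n : WithTop ℕ∞} :
    ContDiff ℝ n fun s => √(logDiscriminant ν L m 0 s) := by
  refine ContDiff.sqrt ?_ fun s => (logDiscriminant_pos hν hL m s).ne'
  unfold logDiscriminant expQuadratic
  fun_prop

theorem cgf_eq (hν : ν < 1) (hL : 2 ≤ L) :
    cgf ν L = fun s => (ν - 2) / 2 +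
      (∑ m ∈ Finset.range L, √(logDiscriminant ν L m 0 s)) / (2 * L) := by
  ext s
  have hL' : (L : ℝ) ≠ 0 := Nat.cast_ne_zero.2 (by omega)
  simp only [← modeDiscriminant_exp]
  rw [cgf, limitingCGF_eq (by norm_num) (by linarith) hL, topEigenvalue]
  field_simp
  ring

theorem contDiff_cgf (hν : ν < 1) (hL : 2 ≤ L) {n : WithTop ℕ∞} : ContDiff ℝ n (cgf ν L) := by
  rw [cgf_eq hν hL]
  exact contDiff_const.add ((ContDiff.sum fun m _ =>
    contDiff_sqrt_logDiscriminant hν (by omega) m).div_const _)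

theorem criticalCumulant_eq_sum (hν : ν < 1) (hL : 2 ≤ L) {n : ℕ} (hn : 0 < n) :
    criticalCumulant ν n L = (∑ m ∈ Finset.range L,
      iteratedDeriv n (fun s => √(logDiscriminant ν L m 0 s)) (sCrit ν)) / (2 * L) := by
  rw [criticalCumulant, cgf_eq hν hL, iteratedDeriv_const_add hn, iteratedDeriv_div_const,
    iteratedDeriv_fun_sum fun m _ =>
      (contDiff_sqrt_logDiscriminant hν (by omega : L ≠ 0) m).contDiffAt]

/-- The discriminant of the mode of momentum `q` at the critical point, divided by `4 σ²` with
`σ = sin (q / 2)`. -/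
noncomputable def critRho (ν σ : ℝ) : ℝ := 1 - ν ^ 2 + ν ^ 2 * σ ^ 2

/-- The derivative of the discriminant of the mode of momentum `q` at the critical point, divided
by `4 ν σ²` with `σ = sin (q / 2)`. -/
noncomputable def critTheta (ν σ : ℝ) : ℝ := 1 - 2 * ν + 2 * ν * σ ^ 2

/-- The numerator of the simple pole at `σ = 0` of the contribution of the mode of momentum `q` to
the second critical cumulant, with `σ = sin (q / 2)`. -/
noncomputable def critProfileTwo (ν σ : ℝ) : ℝ :=
  (2 * ν ^ 2 * (1 - 2 * σ ^ 2) ^ 2 + 4 * ν * σ ^ 2 * critTheta ν σ) / (4 * √(critRho ν σ)) -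
    ν ^ 2 * σ ^ 2 * critTheta ν σ ^ 2 / (2 * (critRho ν σ * √(critRho ν σ)))

/-- The numerator of the simple pole at `σ = 0` of the contribution of the mode of momentum `q` to
the third critical cumulant, with `σ = sin (q / 2)`. -/
noncomputable def critProfileThree (ν σ : ℝ) : ℝ :=
  (6 * ν ^ 2 * (1 - 2 * σ ^ 2) ^ 2 + 4 * ν * σ ^ 2 * critTheta ν σ) / (4 * √(critRho ν σ)) -
    3 * ν * critTheta ν σ * (2 * ν ^ 2 * (1 - 2 * σ ^ 2) ^ 2 + 4 * ν * σ ^ 2 * critTheta ν σ) /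
      (8 * (critRho ν σ * √(critRho ν σ))) +
    3 * ν ^ 3 * σ ^ 2 * critTheta ν σ ^ 3 / (4 * (critRho ν σ ^ 2 * √(critRho ν σ)))

theorem critRho_pos (hν0 : 0 < ν) (hν : ν < 1) (σ : ℝ) : 0 < critRho ν σ := by
  have : 0 < 1 - ν ^ 2 := by nlinarith
  unfold critRho
  positivity

theorem contDiff_critRho (ν : ℝ) {n : WithTop ℕ∞} : ContDiff ℝ n (critRho ν) := by
  unfold critRho
  fun_prop

theorem contDiff_critTheta (ν : ℝ) {n : WithTop ℕ∞} : ContDiff ℝ n (critTheta ν) := by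
  unfold critTheta
  fun_prop

theorem contDiff_critProfileTwo (hν0 : 0 < ν) (hν : ν < 1) {n : WithTop ℕ∞} :
    ContDiff ℝ n (critProfileTwo ν) := by
  have hpos := critRho_pos hν0 hν
  have hsqrt (σ) : √(critRho ν σ) ≠ 0 := (Real.sqrt_pos.2 (hpos σ)).ne'
  have hρ := contDiff_critRho ν (n := n)
  have hθ := contDiff_critTheta ν (n := n)
  have hsqrtρ := hρ.sqrt fun σ => (hpos σ).ne'
  refine ContDiff.sub (ContDiff.div (by fun_prop) (by fun_prop) fun σ => ?_)
    (ContDiff.div (by fun_prop) (by fun_prop) fun σ => ?_) <;>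
  · have := hpos σ
    have := hsqrt σ
    positivity

theorem contDiff_critProfileThree (hν0 : 0 < ν) (hν : ν < 1) {n : WithTop ℕ∞} :
    ContDiff ℝ n (critProfileThree ν) := by
  have hpos := critRho_pos hν0 hν
  have hsqrt (σ) : √(critRho ν σ) ≠ 0 := (Real.sqrt_pos.2 (hpos σ)).ne'
  have hρ := contDiff_critRho ν (n := n)
  have hθ := contDiff_critTheta ν (n := n)
  have hsqrtρ := hρ.sqrt fun σ => (hpos σ).ne'
  refine ContDiff.add (ContDiff.sub (ContDiff.div (by fun_prop) (by fun_prop) fun σ => ?_)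
    (ContDiff.div (by fun_prop) (by fun_prop) fun σ => ?_))
    (ContDiff.div (by fun_prop) (by fun_prop) fun σ => ?_) <;>
  · have := hpos σ
    have := hsqrt σ
    positivity

theorem logDiscriminant_sCrit (hν0 : 0 < ν) (L m k : ℕ) :
    logDiscriminant ν L m k (sCrit ν) =
      ((1 - ν) ^ 2 + 1 - 2 * (1 - ν) * (1 - 2 * Real.sin (momentum L m / 2) ^ 2)) * 0 ^ k +
      (2 * (1 - ν) - 2 * (1 - 2 * Real.sin (momentum L m / 2) ^ 2)) * ν +
      (1 - 2 * Real.sin (momentum L m / 2) ^ 2) ^ 2 * 2 ^ k * ν ^ 2 := by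
  have hcos : Real.cos (momentum L m) = 1 - 2 * Real.sin (momentum L m / 2) ^ 2 := by
    rw [Real.sin_sq_eq_half_sub]
    ring_nf
  have hcrit : sCrit ν = Real.log ν := by
    rw [sCrit]
    ring_nf
  rw [logDiscriminant, expQuadratic, hcos, hcrit, two_mul (Real.log ν), Real.exp_add,
    Real.exp_log hν0, ← sq]

theorem logDiscriminant_zero_sCrit (hν0 : 0 < ν) (L m : ℕ) :
    logDiscriminant ν L m 0 (sCrit ν) =
      4 * Real.sin (momentum L m / 2) ^ 2 * critRho ν (Real.sin (momentum L m / 2)) := by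
  rw [logDiscriminant_sCrit hν0, critRho]
  ring

theorem logDiscriminant_one_sCrit (hν0 : 0 < ν) (L m : ℕ) :
    logDiscriminant ν L m 1 (sCrit ν) =
      4 * ν * Real.sin (momentum L m / 2) ^ 2 * critTheta ν (Real.sin (momentum L m / 2)) := by
  rw [logDiscriminant_sCrit hν0, critTheta]
  ring

theorem logDiscriminant_two_sCrit (hν0 : 0 < ν) (L m : ℕ) :
    logDiscriminant ν L m 2 (sCrit ν) =
      2 * ν ^ 2 * (1 - 2 * Real.sin (momentum L m / 2) ^ 2) ^ 2 +
        4 * ν * Real.sin (momentum L m / 2) ^ 2 * critTheta ν (Real.sin (momentum L m / 2)) := by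
  rw [logDiscriminant_sCrit hν0, critTheta]
  ring

theorem logDiscriminant_three_sCrit (hν0 : 0 < ν) (L m : ℕ) :
    logDiscriminant ν L m 3 (sCrit ν) =
      6 * ν ^ 2 * (1 - 2 * Real.sin (momentum L m / 2) ^ 2) ^ 2 +
        4 * ν * Real.sin (momentum L m / 2) ^ 2 * critTheta ν (Real.sin (momentum L m / 2)) := by
  rw [logDiscriminant_sCrit hν0, critTheta]
  ring

theorem sqrt_logDiscriminant_sCrit (hν0 : 0 < ν) {m : ℕ} (hm : m < L) :
    √(logDiscriminant ν L m 0 (sCrit ν)) =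
      2 * Real.sin (momentum L m / 2) * √(critRho ν (Real.sin (momentum L m / 2))) := by
  have hσ := sin_half_momentum_pos hm
  rw [logDiscriminant_zero_sCrit hν0, Real.sqrt_mul (by positivity),
    ← Real.sqrt_sq (by positivity : 0 ≤ 2 * Real.sin (momentum L m / 2)), mul_pow]
  norm_num

theorem iteratedDeriv_two_sqrt_logDiscriminant (hν0 : 0 < ν) (hν : ν < 1) {m : ℕ} (hm : m < L) :
    iteratedDeriv 2 (fun s => √(logDiscriminant ν L m 0 s)) (sCrit ν) =
      critProfileTwo ν (Real.sin (momentum L m / 2)) / Real.sin (momentum L m / 2) := by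
  rw [iteratedDeriv_two_sqrt (hasDerivAt_logDiscriminant ν L m 0)
    (hasDerivAt_logDiscriminant ν L m 1) (logDiscriminant_pos hν (Nat.ne_zero_of_lt hm) m)]
  beta_reduce
  have hσ := sin_half_momentum_pos hm
  have hρ := critRho_pos hν0 hν (Real.sin (momentum L m / 2))
  have := Real.sqrt_pos.2 hρ
  rw [sqrt_logDiscriminant_sCrit hν0 hm, logDiscriminant_zero_sCrit hν0,
    logDiscriminant_one_sCrit hν0, logDiscriminant_two_sCrit hν0, critProfileTwo]
  field_simp
  ring

theorem iteratedDeriv_three_sqrt_logDiscriminant (hν0 : 0 < ν) (hν : ν < 1) {m : ℕ} (hm : m < L) :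
    iteratedDeriv 3 (fun s => √(logDiscriminant ν L m 0 s)) (sCrit ν) =
      critProfileThree ν (Real.sin (momentum L m / 2)) / Real.sin (momentum L m / 2) := by
  rw [iteratedDeriv_three_sqrt (hasDerivAt_logDiscriminant ν L m 0)
    (hasDerivAt_logDiscriminant ν L m 1) (hasDerivAt_logDiscriminant ν L m 2)
    (logDiscriminant_pos hν (Nat.ne_zero_of_lt hm) m)]
  beta_reduce
  have hσ := sin_half_momentum_pos hm
  have hρ := critRho_pos hν0 hν (Real.sin (momentum L m / 2))
  have := Real.sqrt_pos.2 hρ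
  rw [sqrt_logDiscriminant_sCrit hν0 hm, logDiscriminant_zero_sCrit hν0,
    logDiscriminant_one_sCrit hν0, logDiscriminant_two_sCrit hν0, logDiscriminant_three_sCrit hν0,
    critProfileThree]
  field_simp
  ring

end Cumulants

section Asymptotics

variable {ν : ℝ}

theorem one_sub_sq_pos (hν0 : 0 < ν) (hν : ν < 1) : 0 < 1 - ν ^ 2 := by
  nlinarith

theorem rpow_three_halves {x : ℝ} (hx : 0 ≤ x) : x ^ (3 / 2 : ℝ) = x * √x := by
  rw [Real.rpow_div_two_eq_sqrt 3 hx, ← Nat.cast_ofNat, Real.rpow_natCast, pow_succ,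
    Real.sq_sqrt hx]

theorem critProfileTwo_zero (ν : ℝ) : critProfileTwo ν 0 = ν ^ 2 / (2 * √(1 - ν ^ 2)) := by
  simp only [critProfileTwo, critRho, zero_pow two_ne_zero, mul_zero, zero_mul, zero_div, add_zero,
    sub_zero]
  ring

theorem critProfileThree_zero (hν0 : 0 < ν) (hν : ν < 1) :
    critProfileThree ν 0 = 3 / 4 * (ν ^ 2 * (2 - ν) / (1 - ν ^ 2) ^ (3 / 2 : ℝ)) := by
  have hpos := one_sub_sq_pos hν0 hν
  have := Real.sqrt_pos.2 hpos
  simp only [critProfileThree, critRho, critTheta, rpow_three_halves hpos.le, zero_pow two_ne_zero,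
    mul_zero, zero_mul, add_zero, sub_zero]
  field_simp
  ring

theorem tendsto_criticalCumulant_two_div_log (hν0 : 0 < ν) (hν : ν < 1) :
    Tendsto (fun L : ℕ => criticalCumulant ν 2 L / Real.log L) atTop
      (𝓝 (ν ^ 2 / (2 * √(1 - ν ^ 2)) / Real.pi)) := by
  rw [← critProfileTwo_zero]
  refine (tendsto_sum_div_sin_div_log (contDiff_critProfileTwo hν0 hν)).congr' ?_
  filter_upwards [eventually_ge_atTop 2] with L hL
  rw [criticalCumulant_eq_sum hν hL two_pos, Finset.sum_congr rfl fun m hm =>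
    iteratedDeriv_two_sqrt_logDiscriminant hν0 hν (Finset.mem_range.1 hm)]

theorem tendsto_criticalCumulant_three_div_log (hν0 : 0 < ν) (hν : ν < 1) :
    Tendsto (fun L : ℕ => criticalCumulant ν 3 L / Real.log L) atTop
      (𝓝 (3 / 4 * (ν ^ 2 * (2 - ν) / ((1 - ν ^ 2) ^ (3 / 2 : ℝ) * Real.pi)))) := by
  rw [← div_div, ← mul_div_assoc, ← critProfileThree_zero hν0 hν]
  refine (tendsto_sum_div_sin_div_log (contDiff_critProfileThree hν0 hν)).congr' ?_
  filter_upwards [eventually_ge_atTop 2] with L hL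
  rw [criticalCumulant_eq_sum hν hL three_pos, Finset.sum_congr rfl fun m hm =>
    iteratedDeriv_three_sqrt_logDiscriminant hν0 hν (Finset.mem_range.1 hm)]

theorem isEquivalent_const_mul_of_tendsto_div {α : Type*} {l : Filter α} {u v : α → ℝ} {c : ℝ}
    (hc : c ≠ 0) (h : Tendsto (fun a => u a / v a) l (𝓝 c)) : u ~[l] fun a => c * v a := by
  refine isEquivalent_of_tendsto_one ?_
  have hdiv := h.div_const c
  rw [div_self hc] at hdiv
  exact hdiv.congr fun a => by rw [Pi.div_apply, div_div, mul_comm]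

theorem div_rpow_three_halves_div_sqrt {a b c l : ℝ} (hb : 0 ≤ b) (hc : 0 ≤ c) (hl : 0 < l) :
    a / l / (b / l) ^ (3 / 2 : ℝ) / √c = a / b ^ (3 / 2 : ℝ) / √(c / l) := by
  have := Real.sqrt_pos.2 hl
  rw [Real.div_rpow hb hl.le, rpow_three_halves hl.le, Real.sqrt_div hc]
  field_simp

theorem criticalSkewness_constant (hν0 : 0 < ν) (hν : ν < 1) :
    3 / 4 * (ν ^ 2 * (2 - ν) / ((1 - ν ^ 2) ^ (3 / 2 : ℝ) * Real.pi)) /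
      (ν ^ 2 / (2 * √(1 - ν ^ 2)) / Real.pi) ^ (3 / 2 : ℝ) / √(Real.pi / 2) =
      3 * (2 - ν) / (ν * (1 - ν ^ 2) ^ (3 / 4 : ℝ)) := by
  have hpos := one_sub_sq_pos hν0 hν
  have hsq : (ν ^ 2) ^ (3 / 2 : ℝ) = ν ^ 3 := by
    rw [rpow_three_halves (sq_nonneg ν), Real.sqrt_sq hν0.le, pow_succ ν 2]
  have hsqrt : √(1 - ν ^ 2) ^ (3 / 2 : ℝ) = (1 - ν ^ 2) ^ (3 / 4 : ℝ) := by
    rw [← Real.rpow_div_two_eq_sqrt _ hpos.le]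
    norm_num
  have hsplit : (1 - ν ^ 2) ^ (3 / 2 : ℝ) =
      (1 - ν ^ 2) ^ (3 / 4 : ℝ) * (1 - ν ^ 2) ^ (3 / 4 : ℝ) := by
    rw [← Real.rpow_add hpos]
    norm_num
  have htwo : (2 : ℝ) ^ (3 / 2 : ℝ) = 2 * √2 := rpow_three_halves two_pos.le
  have hpi : Real.pi ^ (3 / 2 : ℝ) = Real.pi * √Real.pi := rpow_three_halves Real.pi_pos.le
  rw [Real.div_rpow (by positivity) Real.pi_pos.le, Real.div_rpow (by positivity) (by positivity),
    Real.mul_rpow two_pos.le (Real.sqrt_nonneg _), hsq, hsqrt, hsplit, htwo, hpi,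
    Real.sqrt_div Real.pi_pos.le]
  have := Real.rpow_pos_of_pos hpos (3 / 4)
  have := Real.sqrt_pos.2 Real.pi_pos
  field_simp
  rw [Real.sq_sqrt two_pos.le]
  ring

theorem tendsto_criticalSkewness_div_sqrt (hν0 : 0 < ν) (hν : ν < 1) :
    Tendsto (fun L : ℕ => criticalSkewness ν L / √(Real.pi / (2 * Real.log L))) atTop
      (𝓝 (3 * (2 - ν) / (ν * (1 - ν ^ 2) ^ (3 / 4 : ℝ)))) := by
  have hpos := one_sub_sq_pos hν0 hν
  have hlimit_two : 0 < ν ^ 2 / (2 * √(1 - ν ^ 2)) / Real.pi := by positivity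
  have htwo := tendsto_criticalCumulant_two_div_log hν0 hν
  have hratio := ((tendsto_criticalCumulant_three_div_log hν0 hν).div
    (htwo.rpow_const (p := 3 / 2) (Or.inl hlimit_two.ne')) (by positivity)).div_const
    √(Real.pi / 2)
  rw [criticalSkewness_constant hν0 hν] at hratio
  refine hratio.congr' ?_
  filter_upwards [eventually_log_natCast_pos, htwo.eventually_const_lt hlimit_two] with L hlog hdiv
  have hcumulant := (div_pos_iff_of_pos_right hlog).1 hdiv
  rw [Pi.div_apply, div_rpow_three_halves_div_sqrt hcumulant.le (by positivity) hlog,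
    div_div Real.pi, criticalSkewness]

theorem criticalCumulant_three_isEquivalent (hν0 : 0 < ν) (hν : ν < 1) :
    (fun L : ℕ => criticalCumulant ν 3 L) ~[atTop]
      (fun L : ℕ => 3 / 4 * (ν ^ 2 * (2 - ν) / ((1 - ν ^ 2) ^ (3 / 2 : ℝ) * Real.pi))
        * Real.log (L : ℝ)) := by
  have := one_sub_sq_pos hν0 hν
  have : 0 < 2 - ν := by linarith
  exact isEquivalent_const_mul_of_tendsto_div (by positivity)
    (tendsto_criticalCumulant_three_div_log hν0 hν)

theorem criticalSkewness_isEquivalent (hν0 : 0 < ν) (hν : ν < 1) :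
    (fun L : ℕ => criticalSkewness ν L) ~[atTop]
      (fun L : ℕ => 3 * (2 - ν) / (ν * (1 - ν ^ 2) ^ (3 / 4 : ℝ))
        * √(Real.pi / (2 * Real.log (L : ℝ)))) := by
  have := one_sub_sq_pos hν0 hν
  have : 0 < 2 - ν := by linarith
  exact isEquivalent_const_mul_of_tendsto_div (by positivity)
    (tendsto_criticalSkewness_div_sqrt hν0 hν)

theorem tendsto_criticalSkewness (hν0 : 0 < ν) (hν : ν < 1) :
    Tendsto (fun L : ℕ => criticalSkewness ν L) atTop (𝓝 0) := by
  have hsqrt : Tendsto (fun L : ℕ => √(Real.pi / (2 * Real.log (L : ℝ)))) atTop (𝓝 0) := by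
    rw [← Real.sqrt_zero]
    exact (tendsto_const_nhds.div_atTop (tendsto_log_natCast.const_mul_atTop two_pos)).sqrt
  refine (criticalSkewness_isEquivalent hν0 hν).symm.tendsto_nhds ?_
  exact mul_zero (3 * (2 - ν) / (ν * (1 - ν ^ 2) ^ (3 / 4 : ℝ))) ▸ hsqrt.const_mul _

end Asymptotics

end DLPAD

theorem mainTheorem6 (ν : ℝ) (hν0 : 0 < ν) (hν1 : ν < 1) :
    -- the limiting cumulant generating function exists, is the same for all even initial
    -- configurations, and is smooth enough at the critical point
    (∀ L : ℕ, 2 ≤ L →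
      (∀ (η : DLPAD.Config L) (s : ℝ), DLPAD.IsEven η →
        Tendsto (fun t : ℝ => DLPAD.scaledCGF (1 / 2) ((1 - ν) / 2) L η s t) atTop
          (𝓝 (DLPAD.cgf ν L s))) ∧
      ContDiffAt ℝ 3 (DLPAD.cgf ν L) (DLPAD.sCrit ν)) ∧
    -- the critical third cumulant
    (fun L : ℕ => DLPAD.criticalCumulant ν 3 L) ~[atTop]
      (fun L : ℕ => 3 / 4 * (ν ^ 2 * (2 - ν) / ((1 - ν ^ 2) ^ (3 / 2 : ℝ) * Real.pi))
        * Real.log (L : ℝ)) ∧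
    -- the critical skewness
    Tendsto (fun L : ℕ => DLPAD.criticalSkewness ν L) atTop (𝓝 0) ∧
    (fun L : ℕ => DLPAD.criticalSkewness ν L) ~[atTop]
      (fun L : ℕ => 3 * (2 - ν) / (ν * (1 - ν ^ 2) ^ (3 / 4 : ℝ))
        * Real.sqrt (Real.pi / (2 * Real.log (L : ℝ)))) := by
  refine ⟨fun L hL => ⟨fun η s hη => ?_, (DLPAD.contDiff_cgf hν1 hL).contDiffAt⟩,
    DLPAD.criticalCumulant_three_isEquivalent hν0 hν1, DLPAD.tendsto_criticalSkewness hν0 hν1,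
    DLPAD.criticalSkewness_isEquivalent hν0 hν1⟩
  rw [DLPAD.cgf, DLPAD.limitingCGF_eq (by norm_num) (by linarith) hL]
  exact DLPAD.tendsto_scaledCGF (by norm_num) (by linarith) hL hη s
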